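/- Let $k$ be a field, $H$ a Hopf algebra over $k$ with bijective antipode $S$, $C$ a left $H$-module coalgebra, $A\neq 0$ a left $H$-module algebra, and $M$ a right-left stable anti-Yetter--Drinfeld module over $H$ (a right $H$-module and left $H$-comodule with $\nabla(mh)=S(h_{(3)})m_{(-1)}h_{(1)}\otimes m_{(0)}h_{(2)}$ and $m_{(0)}m_{(-1)}=m$). Let $C$ act on $A$ equivariantly: there is a linear map $C\otimes A\to A$, $c\otimes a\mapsto c\triangleright a$, with $c\triangleright(ab)=(c_{(1)}\triangleright a)(c_{(2)}\triangleright b)$, $c\triangleright 1=\varepsilon(c)1$ and $h(c\triangleright a)=(hc)\triangleright a$. Consider the following three cocyclic modules. * $C^n_H(C,M)=M\otimes_H C^{\otimes (n+1)}$. The coface $d_i$ ($0\le i\le n$) applies the comultiplication to $c^i$, the last coface is $d_{n+1}=td_0$, $s_j$ applies $\varepsilon$ to $c^{j+1}$, and $t(m\otimes c^0\otimes\cdots\otimes c^n)=m_{(0)}\otimes c^1\otimes\cdots\otimes c^n\otimes m_{(-1)}c^0$. * $C^n_H(A,M)=\mathrm{Hom}_k(M\otimes_H A^{\otimes(n+1)},k)$.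 The coface $d_i$ ($0\le i\le n$) is dual to the multiplication $a_ia_{i+1}$, the last coface is $d_{n+1}=td_0$, $s_j$ is dual to the insertion of $1$ after $a_j$, and $(t\varphi)(m\otimes a_0\otimes\cdots\otimes a_n)=\varphi(m_{(0)}\otimes S^{-1}(m_{(-1)})a_n\otimes a_0\otimes\cdots\otimes a_{n-1})$. * $C^n(A)=\mathrm{Hom}_k(A^{\otimes (n+1)},k)$, the ordinary cocyclic module of the algebra $A$. For a cocyclic module $X$, its cyclic dual ${}^\circ X$ is the cyclic module with ${}^\circ X_n=X^n$, faces $X^{n+1}\to X^n$ given by $s_0,\dots,s_n,\ s_0t_{n+1}^{-1}$, degeneracies $X^n\to X^{n+1}$ given by $d_1,\dots,d_{n+1}$, and cyclic operator $t_n^{-1}$. The dual cyclic theory ${}^\circ HC^p(X)$ is the $p$-th cyclic homology of ${}^\circ X$, that is, the homology of the total complex of Tsygan's cyclic bicomplex, with its periodicity operator $\mathsf S\colon {}^\circ HC^{p+2}(X)\to{}^\circ HC^p(X)$. Write ${}^\circ HC^p_H(C,M)$, ${}^\circ HC^p_H(A,M)$ and ${}^\circ HC^p(A)$ for the three cocyclic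 modules above. Then: 1. (Janus map) The maps $$J_n\colon C^n_H(C,M)\otimes C^n_H(A,M)\to C^n(A),\qquad J_n\big((m\otimes c^0\otimes\cdots\otimes c^n)\otimes\varphi\big)(a_0\otimes\cdots\otimes a_n)=\varphi\big(m\otimes (c^0\triangleright a_0)\otimes\cdots\otimes (c^n\triangleright a_n)\big)$$ are well defined and commute with all cofaces, codegeneracies and cyclic operators; that is, they form a morphism of cocyclic modules $\mathrm{diag}\big(C_H^\bullet(C,M)\otimes C_H^\bullet(A,M)\big)\to C^\bullet(A)$. 2. (Triviality of the dual cyclic theory of $A$) ${}^\circ HC^\bullet(A)$ is the cyclic homology of a point: ${}^\circ HC^p(A)=0$ for $p$ odd, and for $p$ even the functional $\kappa_p\colon{}^\circ HC^p(A)\to k$ which sends the class of a cycle of the total complex to the value at $1\in A$ of its component in $C^0(A)=\mathrm{Hom}_k(A,k)$ is well defined and an isomorphism. For $p$ odd put $\kappa_p=0$. 3. (The pairing) There is a unique family of bilinear pairings $$\beta_p\colon {}^\circ HC^p_H(C,M)\otimes{}^\circ HC^p_H(A,M)\to k,\qquad p\ge 0,$$ of the form $\beta_p=\kappa_p\circ\mu_p$,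 where $\mu_p\colon {}^\circ HC^p_H(C,M)\otimes{}^\circ HC^p_H(A,M)\to{}^\circ HC^p(A)$ $(p\ge 0)$ is a family of linear maps induced by the Janus map, in the sense that $\mu_0$ is given on representatives by $J_0$, and $\mathsf S\,\mu_{p+2}(\xi\otimes\eta)=\mu_p(\mathsf S\xi\otimes\mathsf S\eta)$ for all $p$, $\xi$, $\eta$. -/

import Mathlib

open scoped TensorProduct
open Coalgebra HopfAlgebra

universe u

namespace HopfCyclic

noncomputable section

/-! ### Cocyclic and cyclic operators, cyclic duality, cyclic homology -/

section Cyclic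

variable (k : Type u) [Field k]

/-- The spaces and the operators of a cocyclic `k`-module: cofaces `d_i : X^n → X^{n+1}`
(`0 ≤ i ≤ n+1`), codegeneracies `s_j : X^{n+1} → X^n` (`0 ≤ j ≤ n`) and cyclic operators
`t_n : X^n → X^n`. -/
structure CocyclicData where
  obj : ℕ → ModuleCat.{u} k
  d : ∀ n : ℕ, Fin (n + 2) → (obj n →ₗ[k] obj (n + 1))
  s : ∀ n : ℕ, Fin (n + 1) → (obj (n + 1) →ₗ[k] obj n)
  t : ∀ n : ℕ, obj n →ₗ[k] obj n

/-- The spaces and the operators of a cyclic `k`-module: faces `F_{n+1} → F_n`,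
degeneracies `F_n → F_{n+1}` and cyclic operators. -/
structure CyclicData where
  obj : ℕ → ModuleCat.{u} k
  face : ∀ n : ℕ, Fin (n + 2) → (obj (n + 1) →ₗ[k] obj n)
  degen : ∀ n : ℕ, Fin (n + 1) → (obj n →ₗ[k] obj (n + 1))
  t : ∀ n : ℕ, obj n →ₗ[k] obj n

variable {k}

/-- Connes' cyclic dual of a cocyclic module: in degree `n` the faces are
`s_0, …, s_{n-1}` and `s_0 t_n⁻¹`, the degeneracies are `d_1, …, d_{n+1}` and the cyclic operator
is `t_n⁻¹`. Since `t_n ^ (n+1) = 1` in a cocyclic module, `t_n⁻¹` is written `t_n ^ n`. -/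
def CocyclicData.dual (X : CocyclicData k) : CyclicData k where
  obj := X.obj
  face n := Fin.lastCases (X.s n 0 ∘ₗ X.t (n + 1) ^ (n + 1)) (fun i => X.s n i)
  degen n i := X.d n i.succ
  t n := X.t n ^ n

namespace CyclicData

variable (F : CyclicData k)

/-- The signed cyclic operator `(-1)^n t_n`. -/
def signedT (n : ℕ) : F.obj n →ₗ[k] F.obj n := (-1 : k) ^ n • F.t n

/-- The Hochschild boundary `b = ∑_{i=0}^{n+1} (-1)^i ∂_i`. -/
def b (n : ℕ) : F.obj (n + 1) →ₗ[k] F.obj n :=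
  ∑ i : Fin (n + 2), (-1 : k) ^ (i : ℕ) • F.face n i

/-- The acyclic boundary `b' = ∑_{i=0}^{n} (-1)^i ∂_i`. -/
def b' (n : ℕ) : F.obj (n + 1) →ₗ[k] F.obj n :=
  ∑ i : Fin (n + 1), (-1 : k) ^ (i : ℕ) • F.face n i.castSucc

/-- The norm operator `∑_{i=0}^{n} ((-1)^n t_n)^i`. -/
def norm (n : ℕ) : F.obj n →ₗ[k] F.obj n := ∑ i ∈ Finset.range (n + 1), F.signedT n ^ i

/-- Total degree `n` of Tsygan's cyclic bicomplex; the entry with index `j` lies in row `j` and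
column `n - j`. -/
abbrev Tot (n : ℕ) : Type u := ∀ j : Fin (n + 1), F.obj j

/-- The total differential of Tsygan's cyclic bicomplex: even columns carry `b`, odd columns carry
`-b'`, the horizontal maps are `1 - (-1)^j t_j` from odd to even columns and the norm from
even to odd columns. -/
def D (n : ℕ) : F.Tot (n + 1) →ₗ[k] F.Tot n :=
  LinearMap.pi fun j : Fin (n + 1) =>
    if Even (n - (j : ℕ)) then
      F.b j ∘ₗ LinearMap.proj (R := k) (φ := fun i : Fin (n + 2) => F.obj i) j.succ +
        (LinearMap.id - F.signedT j) ∘ₗ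
          LinearMap.proj (R := k) (φ := fun i : Fin (n + 2) => F.obj i) j.castSucc
    else
      -(F.b' j ∘ₗ LinearMap.proj (R := k) (φ := fun i : Fin (n + 2) => F.obj i) j.succ) +
        F.norm j ∘ₗ LinearMap.proj (R := k) (φ := fun i : Fin (n + 2) => F.obj i) j.castSucc

/-- Cycles of the total complex. -/
def cycles : (n : ℕ) → Submodule k (F.Tot n)
  | 0 => ⊤
  | n + 1 => LinearMap.ker (F.D n)

/-- Boundaries of the total complex, inside the cycles. -/
def boundaries (n : ℕ) : Submodule k (F.cycles n) :=
  (LinearMap.range (F.D n)).comap (F.cycles n).subtype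

/-- The cyclic homology `HC_n(F)`. -/
abbrev HC (n : ℕ) : Type u := F.cycles n ⧸ F.boundaries n

/-- The class of a cycle. -/
abbrev cls (n : ℕ) : F.cycles n →ₗ[k] F.HC n := (F.boundaries n).mkQ

/-- The projection of total degree `n+2` onto total degree `n` that forgets the first
two columns. -/
def shift (n : ℕ) : F.Tot (n + 2) →ₗ[k] F.Tot n :=
  LinearMap.pi fun j : Fin (n + 1) =>
    LinearMap.proj (R := k) (φ := fun i : Fin (n + 3) => F.obj i) j.castSucc.castSucc

theorem shift_D (n : ℕ) (x : F.Tot (n + 3)) :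
    F.shift n (F.D (n + 2) x) = F.D n (F.shift (n + 1) x) := by
  funext j
  have hj : (j : ℕ) ≤ n := Nat.lt_succ_iff.mp j.2
  have h : Even (n + 2 - (j : ℕ)) ↔ Even (n - (j : ℕ)) := by
    have : n + 2 - (j : ℕ) = (n - j) + 2 := by omega
    rw [this, Nat.even_add]
    simp
  by_cases e : Even (n - (j : ℕ))
  · have e' := h.mpr e
    simp only [shift, D, LinearMap.pi_apply, LinearMap.proj_apply, Fin.val_castSucc, e', e, if_true]
    rfl
  · have e' : ¬ Even (n + 2 - (j : ℕ)) := fun q => e (h.mp q)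
    simp only [shift, D, LinearMap.pi_apply, LinearMap.proj_apply, Fin.val_castSucc, if_neg e',
      if_neg e]
    rfl

theorem shift_mem_cycles (n : ℕ) (x : F.Tot (n + 2)) (hx : x ∈ F.cycles (n + 2)) :
    F.shift n x ∈ F.cycles n := by
  cases n with
  | zero => exact Submodule.mem_top
  | succ m =>
    have hx' : F.D (m + 2) x = 0 := hx
    change F.D m (F.shift (m + 1) x) = 0
    rw [← shift_D, hx', map_zero]

/-- Connes' periodicity operator `S : HC_{n+2}(F) → HC_n(F)`. -/
def S (n : ℕ) : F.HC (n + 2) →ₗ[k] F.HC n :=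
  Submodule.mapQ _ _ ((F.shift n).restrict (F.shift_mem_cycles n)) (by
    rintro ⟨x, hx⟩ ⟨y, hy⟩
    exact ⟨F.shift (n + 1) y, by rw [← shift_D, hy]; rfl⟩)

theorem D_zero_apply_eq_zero (e : F.obj 0 →ₗ[k] k)
    (he : ∀ v, e (F.face 0 0 v) = e (F.face 0 1 v)) (ht : F.t 0 = LinearMap.id) (p : ℕ)
    (hp : Even p) (y : F.Tot (p + 1)) : e (F.D p y 0) = 0 := by
  have e' : Even (p - ((0 : Fin (p + 1)) : ℕ)) := by simpa using hp
  have hb : ∀ v : F.obj 1, e (F.b 0 v) = 0 := by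
    intro v
    have h : F.b 0 v = F.face 0 0 v - F.face 0 1 v := by
      simp [b, Fin.sum_univ_two, sub_eq_add_neg]
    rw [h, map_sub, he, sub_self]
  have hs : ∀ v : F.obj 0, e (v - F.signedT 0 v) = 0 := by
    intro v
    simp [signedT, ht]
  have hD : F.D p y 0 = F.b 0 (show F.obj 1 from y 1) +
      ((show F.obj 0 from y 0) - F.signedT 0 (show F.obj 0 from y 0)) := by
    simp only [D, LinearMap.pi_apply, if_pos e']
    rfl
  rw [hD]
  refine (map_add e _ _).trans ?_
  rw [hs]
  exact (add_zero _).trans (hb _)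

end CyclicData

/-- The dual cyclic theory `°HC^n(X)` of a cocyclic module `X`: the cyclic homology of its
cyclic dual. -/
abbrev DualHC (X : CocyclicData k) (n : ℕ) : Type u := X.dual.HC n

/-- `J` is a morphism of cocyclic modules from the diagonal of `X ⊗ Y` to `Z`. -/
structure IsDiagonalMorphism (X Y Z : CocyclicData k)
    (J : ∀ n : ℕ, X.obj n →ₗ[k] Y.obj n →ₗ[k] Z.obj n) : Prop where
  d : ∀ n i x y, J (n + 1) (X.d n i x) (Y.d n i y) = Z.d n i (J n x y)
  s : ∀ n j x y, J n (X.s n j x) (Y.s n j y) = Z.s n j (J (n + 1) x y)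
  t : ∀ n x y, J n (X.t n x) (Y.t n y) = Z.t n (J n x y)

/-- A family of bilinear maps `°HC^p(X) × °HC^p(Y) → °HC^p(Z)` is induced by
`J : X^n ⊗ Y^n → Z^n` if in degree zero it is given by `J` on representatives, and if it is
multiplicative with respect to the periodicity operators. -/
structure IsInducedProduct (X Y Z : CocyclicData k)
    (J : ∀ n : ℕ, X.obj n →ₗ[k] Y.obj n →ₗ[k] Z.obj n)
    (μ : ∀ p : ℕ, DualHC X p →ₗ[k] DualHC Y p →ₗ[k] DualHC Z p) : Prop where
  degree_zero : ∀ (x : X.dual.cycles 0) (y : Y.dual.cycles 0) (z : Z.dual.cycles 0),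
    z.1 0 = J 0 (x.1 0) (y.1 0) →
      μ 0 (X.dual.cls 0 x) (Y.dual.cls 0 y) = Z.dual.cls 0 z
  periodicity : ∀ (p : ℕ) (ξ : DualHC X (p + 2)) (η : DualHC Y (p + 2)),
    Z.dual.S p (μ (p + 2) ξ η) = μ p (X.dual.S p ξ) (Y.dual.S p η)

end Cyclic

/-! ### Tensor powers -/

section TensorPowers

variable (k : Type u) [Field k]

/-- The tensor power `V^{⊗ n}`, with `V^{⊗ 0} = k` and `V^{⊗ (n+1)} = V ⊗ V^{⊗ n}`. -/
def TPow (V : Type u) [AddCommGroup V] [Module k V] : ℕ → ModuleCat.{u} k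
  | 0 => ModuleCat.of k k
  | n + 1 => ModuleCat.of k (V ⊗[k] (TPow V n))

variable {k} {V : Type u} [AddCommGroup V] [Module k V]

/-- `V^{⊗ 0} = k`. -/
def TPow.nil : k ≃ₗ[k] TPow k V 0 := LinearEquiv.refl k k

/-- `V^{⊗ (n+1)} = V ⊗ V^{⊗ n}`. -/
def TPow.cons (n : ℕ) : (V ⊗[k] TPow k V n) ≃ₗ[k] TPow k V (n + 1) :=
  LinearEquiv.refl k (V ⊗[k] TPow k V n)

/-- `v₀ ⊗ v₁ ⊗ ⋯ ⊗ vₙ ↦ v₁ ⊗ ⋯ ⊗ vₙ ⊗ v₀`. -/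
def firstLast : (n : ℕ) → (V ⊗[k] TPow k V n) →ₗ[k] (V ⊗[k] TPow k V n)
  | 0 => LinearMap.id
  | n + 1 =>
    (TPow.cons n).toLinearMap.lTensor V ∘ₗ (firstLast n).lTensor V ∘ₗ
      (TensorProduct.leftComm k V V (TPow k V n)).toLinearMap ∘ₗ
      (TPow.cons n).symm.toLinearMap.lTensor V

/-- `v₀ ⊗ v₁ ⊗ ⋯ ⊗ vₙ ↦ vₙ ⊗ v₀ ⊗ ⋯ ⊗ vₙ₋₁`. -/
def lastFirst : (n : ℕ) → (V ⊗[k] TPow k V n) →ₗ[k] (V ⊗[k] TPow k V n)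
  | 0 => LinearMap.id
  | n + 1 =>
    (TPow.cons n).toLinearMap.lTensor V ∘ₗ
      (TensorProduct.leftComm k V V (TPow k V n)).toLinearMap ∘ₗ
      (lastFirst n).lTensor V ∘ₗ (TPow.cons n).symm.toLinearMap.lTensor V

/-- For a coalgebra `D` and linear maps `ρ : D → Hom(V, V')`, `σ : D → Hom(W, W')`: the map
`D → Hom(V ⊗ W, V' ⊗ W')`, `h ↦ (v ⊗ w ↦ ρ(h₍₁₎) v ⊗ σ(h₍₂₎) w)`. -/
def tensorAct {D V V' W W' : Type u} [AddCommGroup D] [Module k D] [Coalgebra k D]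
    [AddCommGroup V] [Module k V] [AddCommGroup V'] [Module k V']
    [AddCommGroup W] [Module k W] [AddCommGroup W'] [Module k W']
    (ρ : D →ₗ[k] V →ₗ[k] V') (σ : D →ₗ[k] W →ₗ[k] W') :
    D →ₗ[k] (V ⊗[k] W) →ₗ[k] (V' ⊗[k] W') :=
  TensorProduct.map₂ ρ σ ∘ₗ comul

end TensorPowers

/-! ### Module algebras, module coalgebras, coefficients -/

section Hopf

variable (k H : Type u) [Field k] [Ring H] [HopfAlgebra k H]

/-- The antipode of `H` is bijective. -/
class BijectiveAntipode : Prop where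
  bijective : Function.Bijective (antipode k (A := H))

/-- The inverse of the antipode. -/
def antipodeInv [BijectiveAntipode k H] : H →ₗ[k] H :=
  (LinearEquiv.ofBijective (antipode k (A := H)) BijectiveAntipode.bijective).symm.toLinearMap

/-- The left action of `H` on a left `H`-module, as a bilinear map. -/
def leftAct (V : Type u) [AddCommGroup V] [Module k V] [Module H V] [IsScalarTower k H V] :
    H →ₗ[k] V →ₗ[k] V :=
  (Algebra.lsmul k k V).toLinearMap

/-- The right action of `H` on a right `H`-module, as a bilinear map `h ↦ (m ↦ m h)`. -/
def rightAct (M : Type u) [AddCommGroup M] [Module k M] [Module Hᵐᵒᵖ M]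
    [IsScalarTower k Hᵐᵒᵖ M] : H →ₗ[k] M →ₗ[k] M :=
  (Algebra.lsmul k k M).toLinearMap ∘ₗ (MulOpposite.opLinearEquiv k).toLinearMap

/-- `C` is a left `H`-module coalgebra: `Δ(h c) = h₍₁₎ c₍₁₎ ⊗ h₍₂₎ c₍₂₎` and
`ε(h c) = ε(h) ε(c)`. -/
class ModuleCoalgebra (C : Type u) [AddCommGroup C] [Module k C] [Coalgebra k C] [Module H C]
    [IsScalarTower k H C] : Prop where
  comul_smul : ∀ (h : H) (c : C),
    (comul (h • c) : C ⊗[k] C) = tensorAct (leftAct k H C) (leftAct k H C) h (comul c)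
  counit_smul : ∀ (h : H) (c : C), (counit (h • c) : k) = counit h * counit c

/-- `A` is a left `H`-module algebra: `h (a b) = (h₍₁₎ a) (h₍₂₎ b)` and `h 1 = ε(h) 1`. -/
class ModuleAlgebra (A : Type u) [Ring A] [Algebra k A] [Module H A]
    [IsScalarTower k H A] : Prop where
  smul_mul : ∀ (h : H) (a b : A),
    h • (a * b) = LinearMap.mul' k A (tensorAct (leftAct k H A) (leftAct k H A) h (a ⊗ₜ b))
  smul_one : ∀ h : H, h • (1 : A) = algebraMap k A (counit h)

/-- A right-left stable anti-Yetter-Drinfeld module: a right `H`-module `M` with a left coaction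
`∇ m = m₍₋₁₎ ⊗ m₍₀₎` such that `∇(m h) = S(h₍₃₎) m₍₋₁₎ h₍₁₎ ⊗ m₍₀₎ h₍₂₎` and
`m₍₀₎ m₍₋₁₎ = m`. In `anti_yetter_drinfeld` the sums run over `Δ h = ∑ xᵢ ⊗ yᵢ` and
`Δ yᵢ = ∑ pᵢⱼ ⊗ qᵢⱼ`. -/
class SAYDModule (M : Type u) [AddCommGroup M] [Module k M] [Module Hᵐᵒᵖ M]
    [IsScalarTower k Hᵐᵒᵖ M] where
  coact : M →ₗ[k] H ⊗[k] M
  coassoc : ∀ m : M,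
    TensorProduct.assoc k H H M ((comul (R := k) (A := H)).rTensor M (coact m)) =
      coact.lTensor H (coact m)
  counit_coact : ∀ m : M,
    TensorProduct.lid k M ((counit (R := k) (A := H)).rTensor M (coact m)) = m
  anti_yetter_drinfeld : ∀ (m : M) (h : H),
    coact (rightAct k H M h m) =
      ∑ i ∈ (ℛ k h).index, ∑ j ∈ (ℛ k ((ℛ k h).right i)).index,
        TensorProduct.map
          (LinearMap.mulLeft k (antipode k ((ℛ k ((ℛ k h).right i)).right j)) ∘ₗ
            LinearMap.mulRight k ((ℛ k h).left i))
          (rightAct k H M ((ℛ k ((ℛ k h).right i)).left j))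
          (coact m)
  stable : ∀ m : M, TensorProduct.lift (rightAct k H M) (coact m) = m

/-- An equivariant action of the `H`-module coalgebra `C` on the `H`-module algebra `A`:
`c (a b) = (c₍₁₎ a) (c₍₂₎ b)`, `c 1 = ε(c) 1` and `h (c a) = (h c) a`. -/
structure EquivariantAction (C A : Type u) [AddCommGroup C] [Module k C] [Coalgebra k C]
    [Module H C] [Ring A] [Algebra k A] [Module H A] where
  act : C →ₗ[k] A →ₗ[k] A
  act_mul : ∀ (c : C) (a b : A),
    act c (a * b) = LinearMap.mul' k A (tensorAct act act c (a ⊗ₜ b))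
  act_one : ∀ c : C, act c 1 = algebraMap k A (counit c)
  smul_act : ∀ (h : H) (c : C) (a : A), h • act c a = act (h • c) a

/-! ### The balanced tensor product -/

variable {k H}

/-- The diagonal action of `H` on `V^{⊗ n}`. -/
def diag (V : Type u) [AddCommGroup V] [Module k V] [Module H V] [IsScalarTower k H V] :
    (n : ℕ) → H →ₗ[k] TPow k V n →ₗ[k] TPow k V n
  | 0 => (LinearMap.toSpanSingleton k (TPow k V 0 →ₗ[k] TPow k V 0) LinearMap.id) ∘ₗ counit
  | n + 1 => (TPow.cons n).conj.toLinearMap ∘ₗ tensorAct (leftAct k H V) (diag V n)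

section Balanced

variable (M : Type u) [AddCommGroup M] [Module k M] [Module Hᵐᵒᵖ M] [IsScalarTower k Hᵐᵒᵖ M]

/-- The relations `m h ⊗ w = m ⊗ h w`, for a left `H`-action `σ` on `W`. -/
def balancedRel {W : Type u} [AddCommGroup W] [Module k W] (σ : H →ₗ[k] W →ₗ[k] W) :
    Submodule k (M ⊗[k] W) :=
  Submodule.span k {z | ∃ (m : M) (h : H) (w : W),
    z = rightAct k H M h m ⊗ₜ[k] w - m ⊗ₜ[k] σ h w}

/-- `M ⊗_H W`. -/
abbrev Balanced {W : Type u} [AddCommGroup W] [Module k W] (σ : H →ₗ[k] W →ₗ[k] W) : Type u :=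
  (M ⊗[k] W) ⧸ balancedRel M σ

variable {M}

theorem balanced_eq {W : Type u} [AddCommGroup W] [Module k W] (σ : H →ₗ[k] W →ₗ[k] W)
    (m : M) (h : H) (w : W) :
    (balancedRel M σ).mkQ (rightAct k H M h m ⊗ₜ[k] w) =
      (balancedRel M σ).mkQ (m ⊗ₜ[k] σ h w) := by
  rw [← sub_eq_zero, ← map_sub]
  exact (Submodule.Quotient.mk_eq_zero _).mpr (Submodule.subset_span ⟨m, h, w, rfl⟩)

/-- Descent of a linear map to `M ⊗_H W`. -/
def balancedLift {W N : Type u} [AddCommGroup W] [Module k W] [AddCommGroup N] [Module k N]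
    (σ : H →ₗ[k] W →ₗ[k] W) (f : M ⊗[k] W →ₗ[k] N)
    (hf : ∀ m h w, f (rightAct k H M h m ⊗ₜ[k] w) = f (m ⊗ₜ[k] σ h w)) :
    Balanced M σ →ₗ[k] N :=
  (balancedRel M σ).liftQ f (by
    refine Submodule.span_le.mpr ?_
    rintro _ ⟨m, h, w, rfl⟩
    simp [hf])

/-- `f : W → W'` commutes with the actions of `H`. -/
def Equivariant {W W' : Type u} [AddCommGroup W] [Module k W] [AddCommGroup W'] [Module k W']
    (σ : H →ₗ[k] W →ₗ[k] W) (σ' : H →ₗ[k] W' →ₗ[k] W') (f : W →ₗ[k] W') : Prop :=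
  ∀ h w, f (σ h w) = σ' h (f w)

/-- `id_M ⊗_H f`. -/
def balancedMap {W W' : Type u} [AddCommGroup W] [Module k W] [AddCommGroup W'] [Module k W']
    {σ : H →ₗ[k] W →ₗ[k] W} {σ' : H →ₗ[k] W' →ₗ[k] W'} (f : W →ₗ[k] W')
    (hf : Equivariant σ σ' f) : Balanced M σ →ₗ[k] Balanced M σ' :=
  balancedLift σ ((balancedRel M σ').mkQ ∘ₗ f.lTensor M) (by
    intro m h w
    simp only [LinearMap.comp_apply, LinearMap.lTensor_tmul, balanced_eq, hf h w])

end Balanced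

/-! ### Operators on tensor powers and their equivariance -/

section Equivariance

theorem tensorAct_apply {D V V' W W' : Type u} [AddCommGroup D] [Module k D] [Coalgebra k D]
    [AddCommGroup V] [Module k V] [AddCommGroup V'] [Module k V']
    [AddCommGroup W] [Module k W] [AddCommGroup W'] [Module k W']
    (ρ : D →ₗ[k] V →ₗ[k] V') (σ : D →ₗ[k] W →ₗ[k] W') {ι : Type*} {h : D} (r : Repr k h ι)
    (v : V) (w : W) :
    tensorAct ρ σ h (v ⊗ₜ[k] w) = ∑ i ∈ r.index, ρ (r.left i) v ⊗ₜ[k] σ (r.right i) w := by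
  simp [tensorAct, ← r.eq, map_sum, LinearMap.sum_apply]

theorem tensorAct_lTensor {D V V' W W' U U' : Type u} [AddCommGroup D] [Module k D]
    [Coalgebra k D] [AddCommGroup V] [Module k V] [AddCommGroup V'] [Module k V']
    [AddCommGroup W] [Module k W] [AddCommGroup W'] [Module k W']
    [AddCommGroup U] [Module k U] [AddCommGroup U'] [Module k U']
    (ρ : D →ₗ[k] V →ₗ[k] V') (σ : D →ₗ[k] W →ₗ[k] W') (τ : D →ₗ[k] U →ₗ[k] U')
    (f : W →ₗ[k] U) (f' : W' →ₗ[k] U') (hf : ∀ h w, f' (σ h w) = τ h (f w)) (h : D)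
    (z : V ⊗[k] W) :
    f'.lTensor V' (tensorAct ρ σ h z) = tensorAct ρ τ h (f.lTensor V z) := by
  induction z using TensorProduct.induction_on with
  | zero => simp
  | add x y hx hy => simp only [map_add, hx, hy]
  | tmul v w =>
    simp only [LinearMap.lTensor_tmul, tensorAct_apply _ _ (ℛ k h), map_sum, hf]

theorem sum_map_counit_smul {D V W : Type u} [AddCommGroup D] [Module k D] [Coalgebra k D]
    [AddCommGroup V] [Module k V] [AddCommGroup W] [Module k W] (f : D →ₗ[k] V) (w : W) (h : D) :
    ∑ i ∈ (ℛ k h).index, f ((ℛ k h).left i) ⊗ₜ[k] ((counit ((ℛ k h).right i) : k) • w) =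
      f h ⊗ₜ[k] w := by
  have := congrArg (TensorProduct.map f (LinearMap.toSpanSingleton k W w))
    (sum_tmul_counit_eq (ℛ k h))
  simpa only [map_sum, TensorProduct.map_tmul, LinearMap.toSpanSingleton_apply, one_smul] using this

theorem sum_counit_smul_map {D V W : Type u} [AddCommGroup D] [Module k D] [Coalgebra k D]
    [AddCommGroup V] [Module k V] [AddCommGroup W] [Module k W] (f : D →ₗ[k] V) (w : W) (h : D) :
    ∑ i ∈ (ℛ k h).index, ((counit ((ℛ k h).left i) : k) • w) ⊗ₜ[k] f ((ℛ k h).right i) =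
      w ⊗ₜ[k] f h := by
  have := congrArg (TensorProduct.map (LinearMap.toSpanSingleton k W w) f)
    (sum_counit_tmul_eq (ℛ k h))
  simpa only [map_sum, TensorProduct.map_tmul, LinearMap.toSpanSingleton_apply, one_smul] using this

theorem sum_coassoc {D V W U : Type u} [AddCommGroup D] [Module k D] [Coalgebra k D]
    [AddCommGroup V] [Module k V] [AddCommGroup W] [Module k W] [AddCommGroup U] [Module k U]
    (f : D →ₗ[k] V) (g : D →ₗ[k] W) (l : D →ₗ[k] U) (h : D) :
    ∑ i ∈ (ℛ k h).index, ∑ j ∈ (ℛ k ((ℛ k h).left i)).index,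
        f ((ℛ k ((ℛ k h).left i)).left j) ⊗ₜ[k]
          (g ((ℛ k ((ℛ k h).left i)).right j) ⊗ₜ[k] l ((ℛ k h).right i)) =
      ∑ i ∈ (ℛ k h).index, ∑ j ∈ (ℛ k ((ℛ k h).right i)).index,
        f ((ℛ k h).left i) ⊗ₜ[k]
          (g ((ℛ k ((ℛ k h).right i)).left j) ⊗ₜ[k] l ((ℛ k ((ℛ k h).right i)).right j)) := by
  have := congrArg (TensorProduct.map f (TensorProduct.map g l))
    (sum_tmul_tmul_eq (ℛ k h) (fun i => ℛ k _) (fun i => ℛ k _))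
  simpa only [map_sum, TensorProduct.map_tmul] using this

variable {V : Type u} [AddCommGroup V] [Module k V] [Module H V] [IsScalarTower k H V]

theorem diag_cons (n : ℕ) (h : H) (z : V ⊗[k] TPow k V n) :
    diag V (n + 1) h (TPow.cons n z) =
      TPow.cons n (tensorAct (leftAct k H V) (diag V n) h z) := by
  simp [diag, LinearEquiv.conj_apply]

theorem diag_nil (h : H) (a : k) :
    diag V 0 h (TPow.nil a) = TPow.nil ((counit h : k) * a) := by
  rw [← smul_eq_mul, map_smul]
  simp [diag]

theorem diag_zero (h : H) (w : TPow k V 0) : diag V 0 h w = (counit h : k) • w := by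
  simp [diag]

/-- `id_V ⊗ f`. -/
def underCons {n m : ℕ} (f : TPow k V n →ₗ[k] TPow k V m) :
    TPow k V (n + 1) →ₗ[k] TPow k V (m + 1) :=
  (TPow.cons m).toLinearMap ∘ₗ f.lTensor V ∘ₗ (TPow.cons n).symm.toLinearMap

theorem underCons_equivariant {n m : ℕ} {f : TPow k V n →ₗ[k] TPow k V m}
    (hf : Equivariant (k := k) (H := H) (diag V n) (diag V m) f) :
    Equivariant (k := k) (H := H) (diag V (n + 1)) (diag V (m + 1)) (underCons f) := by
  intro h w
  obtain ⟨z, rfl⟩ := (TPow.cons n).surjective w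
  simp only [diag_cons, underCons, LinearMap.comp_apply, LinearEquiv.coe_coe,
    LinearEquiv.symm_apply_apply]
  rw [tensorAct_lTensor _ _ _ _ _ hf]

theorem firstLast_succ (n : ℕ) (a b : V) (w : TPow k V n) :
    firstLast (n + 1) (a ⊗ₜ[k] TPow.cons n (b ⊗ₜ[k] w)) =
      b ⊗ₜ[k] TPow.cons n (firstLast n (a ⊗ₜ[k] w)) := by
  simp [firstLast]

theorem firstLast_act (n : ℕ) (h : H) (v : V) (w : TPow k V n) :
    tensorAct (leftAct k H V) (diag V n) h (firstLast n (v ⊗ₜ[k] w)) =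
      firstLast n (TensorProduct.comm k _ _
        (tensorAct (diag V n) (leftAct k H V) h (w ⊗ₜ[k] v))) := by
  induction n generalizing h v with
  | zero =>
    simp only [firstLast, LinearMap.id_apply, tensorAct_apply _ _ (ℛ k h), diag_zero, map_sum,
      TensorProduct.comm_tmul]
    have e₁ := sum_map_counit_smul ((leftAct k H V).flip v) w h
    have e₂ := congrArg (TensorProduct.comm k _ _)
      (sum_counit_smul_map ((leftAct k H V).flip v) w h)
    simp only [map_sum, TensorProduct.comm_tmul, LinearMap.flip_apply] at e₁ e₂
    exact e₁.trans e₂.symm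
  | succ n ih =>
    obtain ⟨z, rfl⟩ := (TPow.cons n).surjective w
    induction z using TensorProduct.induction_on with
    | zero => simp
    | add x y hx hy => simp only [map_add, TensorProduct.tmul_add, TensorProduct.add_tmul, hx, hy]
    | tmul b w =>
      have key := congrArg (((TPow.cons n).toLinearMap ∘ₗ firstLast n ∘ₗ
          (TensorProduct.comm k _ _).toLinearMap).lTensor V)
        (sum_coassoc ((leftAct k H V).flip b)
          ((diag V n).flip w) ((leftAct k H V).flip v) h)
      simp only [map_sum, LinearMap.lTensor_tmul, LinearMap.comp_apply, LinearEquiv.coe_coe,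
        TensorProduct.comm_tmul, LinearMap.flip_apply] at key
      rw [firstLast_succ]
      simp only [tensorAct_apply _ _ (ℛ k h), diag_cons, ih, tensorAct_apply _ _ (ℛ k _), map_sum,
        TensorProduct.comm_tmul, TensorProduct.sum_tmul, TensorProduct.tmul_sum, firstLast_succ]
      exact key.symm

theorem lastFirst_succ (n : ℕ) (b : V) (z : V ⊗[k] TPow k V n) :
    lastFirst (n + 1) (b ⊗ₜ[k] TPow.cons n z) =
      (TPow.cons n).toLinearMap.lTensor V
        (TensorProduct.leftComm k V V (TPow k V n) (b ⊗ₜ[k] lastFirst n z)) := by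
  simp [lastFirst]

theorem lastFirst_act (n : ℕ) (h : H) (z : V ⊗[k] TPow k V n) :
    lastFirst n (tensorAct (leftAct k H V) (diag V n) h z) =
      TensorProduct.comm k _ _ (tensorAct (diag V n) (leftAct k H V) h
        (TensorProduct.comm k _ _ (lastFirst n z))) := by
  induction n generalizing h with
  | zero =>
    induction z using TensorProduct.induction_on with
    | zero => simp
    | add x y hx hy => simp only [map_add, hx, hy]
    | tmul v w =>
    simp only [lastFirst, LinearMap.id_apply, tensorAct_apply _ _ (ℛ k h), diag_zero, map_sum,
      TensorProduct.comm_tmul]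
    have e₁ := sum_map_counit_smul ((leftAct k H V).flip v) w h
    have e₂ := congrArg (TensorProduct.comm k _ _)
      (sum_counit_smul_map ((leftAct k H V).flip v) w h)
    simp only [map_sum, TensorProduct.comm_tmul, LinearMap.flip_apply] at e₁ e₂
    exact e₁.trans e₂.symm
  | succ n ih =>
    induction z using TensorProduct.induction_on with
    | zero => simp
    | add x y hx hy => simp only [map_add, hx, hy]
    | tmul b w =>
      obtain ⟨z, rfl⟩ := (TPow.cons n).surjective w
      simp only [tensorAct_apply _ _ (ℛ k h), diag_cons, map_sum, lastFirst_succ, ih]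
      generalize lastFirst n z = y
      induction y using TensorProduct.induction_on with
      | zero => simp
      | add x y hx hy =>
        simp only [map_add, TensorProduct.tmul_add, Finset.sum_add_distrib, hx, hy]
      | tmul a w =>
        have key := congrArg ((TPow.cons n).toLinearMap.lTensor V ∘ₗ
          (TensorProduct.leftComm k _ _ _).toLinearMap ∘ₗ
            (TensorProduct.comm k _ _).toLinearMap.lTensor V)
          (sum_coassoc ((leftAct k H V).flip b)
            ((diag V n).flip w) ((leftAct k H V).flip a) h)
        simp only [map_sum, LinearMap.lTensor_tmul, LinearMap.comp_apply, LinearEquiv.coe_coe,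
          TensorProduct.comm_tmul, LinearMap.flip_apply, TensorProduct.leftComm_tmul] at key
        simp only [tensorAct_apply _ _ (ℛ k _), map_sum, diag_cons, LinearMap.lTensor_tmul,
          LinearEquiv.coe_coe, TensorProduct.leftComm_tmul,
          TensorProduct.comm_tmul, TensorProduct.sum_tmul, TensorProduct.tmul_sum]
        exact key.symm

section CoalgebraSide

variable {C : Type u} [AddCommGroup C] [Module k C] [Coalgebra k C]

/-- `c⁰ ⊗ ⋯ ⊗ cⁿ⁻¹ ↦ c⁰ ⊗ ⋯ ⊗ Δ(cⁱ) ⊗ ⋯ ⊗ cⁿ⁻¹`. -/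
def comulAt : (n : ℕ) → Fin n → (TPow k C n →ₗ[k] TPow k C (n + 1))
  | 0 => Fin.elim0
  | n + 1 => Fin.cases
      ((TPow.cons (n + 1)).toLinearMap ∘ₗ (TPow.cons n).toLinearMap.lTensor C ∘ₗ
        (TensorProduct.assoc k C C (TPow k C n)).toLinearMap ∘ₗ
        (comul (R := k) (A := C)).rTensor (TPow k C n) ∘ₗ (TPow.cons n).symm.toLinearMap)
      (fun i => underCons (comulAt n i))

/-- `c⁰ ⊗ ⋯ ⊗ cⁿ ↦ c⁰ ⊗ ⋯ ⊗ ε(cⁱ) ⊗ ⋯ ⊗ cⁿ`. -/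
def counitAt : (n : ℕ) → Fin (n + 1) → (TPow k C (n + 1) →ₗ[k] TPow k C n)
  | 0 => fun _ => (TensorProduct.lid k (TPow k C 0)).toLinearMap ∘ₗ
      (counit (R := k) (A := C)).rTensor (TPow k C 0) ∘ₗ (TPow.cons 0).symm.toLinearMap
  | n + 1 => Fin.cases
      ((TensorProduct.lid k (TPow k C (n + 1))).toLinearMap ∘ₗ
        (counit (R := k) (A := C)).rTensor (TPow k C (n + 1)) ∘ₗ
          (TPow.cons (n + 1)).symm.toLinearMap)
      (fun i => underCons (counitAt n i))

variable [Module H C] [IsScalarTower k H C] [ModuleCoalgebra k H C]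

theorem comulAt_equivariant (n : ℕ) (i : Fin n) :
    Equivariant (k := k) (H := H) (diag C n) (diag C (n + 1)) (comulAt n i) := by
  induction n with
  | zero => exact i.elim0
  | succ n ih =>
    refine Fin.cases ?_ (fun i => ?_) i
    · intro h w
      obtain ⟨z, rfl⟩ := (TPow.cons n).surjective w
      induction z using TensorProduct.induction_on with
      | zero => simp
      | add x y hx hy => simp only [map_add, hx, hy]
      | tmul c w =>
        simp only [comulAt, Fin.cases_zero, LinearMap.comp_apply, diag_cons, LinearEquiv.coe_coe,
          LinearEquiv.symm_apply_apply, tensorAct_apply _ _ (ℛ k h), map_sum,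
          LinearMap.rTensor_tmul]
        have hc : ∀ g : H, (comul (leftAct k H C g c) : C ⊗[k] C) =
            tensorAct (leftAct k H C) (leftAct k H C) g (comul c) :=
          fun g => ModuleCoalgebra.comul_smul (k := k) g c
        simp only [hc]
        generalize (comul c : C ⊗[k] C) = y
        induction y using TensorProduct.induction_on with
        | zero => simp
        | add x y hx hy =>
          simp only [map_add, TensorProduct.add_tmul, Finset.sum_add_distrib, hx, hy]
        | tmul a b =>
          have key := congrArg ((TPow.cons (n + 1)).toLinearMap ∘ₗ
            (TPow.cons n).toLinearMap.lTensor C)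
            (sum_coassoc ((leftAct k H C).flip a)
              ((leftAct k H C).flip b) ((diag C n).flip w) h)
          simp only [map_sum, LinearMap.lTensor_tmul, LinearMap.comp_apply, LinearEquiv.coe_coe,
            LinearMap.flip_apply] at key
          simp only [tensorAct_apply _ _ (ℛ k _), map_sum, diag_cons, LinearMap.lTensor_tmul,
            LinearEquiv.coe_coe, TensorProduct.assoc_tmul,
            TensorProduct.sum_tmul, TensorProduct.tmul_sum]
          exact key
    · exact underCons_equivariant (ih i)

theorem counit_head_equivariant (n : ℕ) :
    Equivariant (k := k) (H := H) (diag C (n + 1)) (diag C n)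
      ((TensorProduct.lid k (TPow k C n)).toLinearMap ∘ₗ
        (counit (R := k) (A := C)).rTensor (TPow k C n) ∘ₗ
          (TPow.cons n).symm.toLinearMap) := by
  intro h w
  obtain ⟨z, rfl⟩ := (TPow.cons n).surjective w
  induction z using TensorProduct.induction_on with
  | zero => simp
  | add x y hx hy => simp only [map_add, hx, hy]
  | tmul c w =>
    have hc : ∀ g : H, (counit (leftAct k H C g c) : k) = counit g * counit c :=
      fun g => ModuleCoalgebra.counit_smul (k := k) g c
    simp only [LinearMap.comp_apply, diag_cons, LinearEquiv.coe_coe,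
      LinearEquiv.symm_apply_apply, tensorAct_apply _ _ (ℛ k h), map_sum,
      LinearMap.rTensor_tmul, TensorProduct.lid_tmul, hc, map_smul]
    conv_rhs => rw [← sum_counit_smul (ℛ k h)]
    simp only [map_sum, LinearMap.sum_apply, map_smul, LinearMap.smul_apply, Finset.smul_sum,
      smul_smul, mul_comm]

theorem counitAt_equivariant (n : ℕ) (i : Fin (n + 1)) :
    Equivariant (k := k) (H := H) (diag C (n + 1)) (diag C n) (counitAt n i) := by
  induction n with
  | zero => exact counit_head_equivariant 0
  | succ n ih =>
    refine Fin.cases ?_ (fun i => ?_) i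
    · exact counit_head_equivariant (n + 1)
    · exact underCons_equivariant (ih i)

end CoalgebraSide

section AlgebraSide

variable {A : Type u} [Ring A] [Algebra k A]

/-- `a₀ ⊗ ⋯ ⊗ aₙ ↦ a₀ ⊗ ⋯ ⊗ aᵢ aᵢ₊₁ ⊗ ⋯ ⊗ aₙ`. -/
def mulAt : (n : ℕ) → Fin n → (TPow k A (n + 1) →ₗ[k] TPow k A n)
  | 0 => Fin.elim0
  | n + 1 => Fin.cases
      ((TPow.cons n).toLinearMap ∘ₗ (LinearMap.mul' k A).rTensor (TPow k A n) ∘ₗ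
        (TensorProduct.assoc k A A (TPow k A n)).symm.toLinearMap ∘ₗ
        (TPow.cons n).symm.toLinearMap.lTensor A ∘ₗ (TPow.cons (n + 1)).symm.toLinearMap)
      (fun i => underCons (mulAt n i))

/-- The insertion of `1` so that it gets index `i`:
`a₀ ⊗ ⋯ ⊗ aₙ₋₁ ↦ a₀ ⊗ ⋯ ⊗ aᵢ₋₁ ⊗ 1 ⊗ aᵢ ⊗ ⋯ ⊗ aₙ₋₁`. -/
def unitAt : (n : ℕ) → Fin (n + 1) → (TPow k A n →ₗ[k] TPow k A (n + 1))
  | 0 => fun _ => (TPow.cons 0).toLinearMap ∘ₗ TensorProduct.mk k A (TPow k A 0) 1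
  | n + 1 => Fin.cases
      ((TPow.cons (n + 1)).toLinearMap ∘ₗ TensorProduct.mk k A (TPow k A (n + 1)) 1)
      (fun i => underCons (unitAt n i))

variable [Module H A] [IsScalarTower k H A] [ModuleAlgebra k H A]

theorem mulAt_equivariant (n : ℕ) (i : Fin n) :
    Equivariant (k := k) (H := H) (diag A (n + 1)) (diag A n) (mulAt n i) := by
  induction n with
  | zero => exact i.elim0
  | succ n ih =>
    refine Fin.cases ?_ (fun i => ?_) i
    · intro h w
      obtain ⟨z, rfl⟩ := (TPow.cons (n + 1)).surjective w
      induction z using TensorProduct.induction_on with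
      | zero => simp
      | add x y hx hy => simp only [map_add, hx, hy]
      | tmul a w =>
        obtain ⟨z, rfl⟩ := (TPow.cons n).surjective w
        induction z using TensorProduct.induction_on with
        | zero => simp
        | add x y hx hy => simp only [map_add, TensorProduct.tmul_add, hx, hy]
        | tmul b w =>
          have hm : ∀ g : H, leftAct k H A g (a * b) =
              LinearMap.mul' k A (tensorAct (leftAct k H A) (leftAct k H A) g (a ⊗ₜ b)) :=
            fun g => ModuleAlgebra.smul_mul (k := k) g a b
          have key := congrArg ((TPow.cons n).toLinearMap ∘ₗ
            (LinearMap.mul' k A).rTensor (TPow k A n) ∘ₗ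
              (TensorProduct.assoc k A A (TPow k A n)).symm.toLinearMap)
            (sum_coassoc ((leftAct k H A).flip a)
              ((leftAct k H A).flip b) ((diag A n).flip w) h)
          simp only [map_sum, LinearMap.comp_apply, LinearEquiv.coe_coe,
            LinearMap.flip_apply, TensorProduct.assoc_symm_tmul, LinearMap.rTensor_tmul] at key
          simp only [mulAt, Fin.cases_zero, LinearMap.comp_apply, diag_cons, LinearEquiv.coe_coe,
            LinearEquiv.symm_apply_apply, tensorAct_apply _ _ (ℛ k h), map_sum,
            LinearMap.rTensor_tmul, LinearMap.lTensor_tmul, tensorAct_apply _ _ (ℛ k _),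
            TensorProduct.tmul_sum, TensorProduct.assoc_symm_tmul, LinearMap.mul'_apply, hm,
            TensorProduct.sum_tmul] at key ⊢
          exact key.symm
    · exact underCons_equivariant (ih i)

theorem unit_head_equivariant (n : ℕ) :
    Equivariant (k := k) (H := H) (diag A n) (diag A (n + 1))
      ((TPow.cons n).toLinearMap ∘ₗ TensorProduct.mk k A (TPow k A n) 1) := by
  intro h w
  have ho : ∀ g : H, leftAct k H A g 1 = (counit g : k) • (1 : A) := fun g => by
    rw [← Algebra.algebraMap_eq_smul_one]
    exact ModuleAlgebra.smul_one (k := k) g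
  have key := congrArg (TPow.cons n) (sum_counit_smul_map ((diag A n).flip w) (1 : A) h)
  simp only [map_sum, LinearMap.flip_apply] at key
  simp only [LinearMap.comp_apply, TensorProduct.mk_apply, LinearEquiv.coe_coe, diag_cons,
    tensorAct_apply _ _ (ℛ k h), ho, map_sum]
  exact key.symm

theorem unitAt_equivariant (n : ℕ) (i : Fin (n + 1)) :
    Equivariant (k := k) (H := H) (diag A n) (diag A (n + 1)) (unitAt n i) := by
  induction n with
  | zero => exact unit_head_equivariant 0
  | succ n ih =>
    refine Fin.cases ?_ (fun i => ?_) i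
    · exact unit_head_equivariant (n + 1)
    · exact underCons_equivariant (ih i)

end AlgebraSide

section Twist

variable {M : Type u} [AddCommGroup M] [Module k M] [Module Hᵐᵒᵖ M] [IsScalarTower k Hᵐᵒᵖ M]
  [SAYDModule k H M]

/-- `m ⊗ v ⊗ w ↦ m₍₀₎ ⊗ f(m₍₋₁₎) v ⊗ w`. -/
def twist (f : H →ₗ[k] H) (W : Type u) [AddCommGroup W] [Module k W] :
    M ⊗[k] (V ⊗[k] W) →ₗ[k] M ⊗[k] (V ⊗[k] W) :=
  (TensorProduct.leftComm k V M W).toLinearMap ∘ₗ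
    (TensorProduct.lift (leftAct k H V ∘ₗ f)).rTensor (M ⊗[k] W) ∘ₗ
    (TensorProduct.tensorTensorTensorComm k H M V W).toLinearMap ∘ₗ
    (SAYDModule.coact (k := k) (H := H) (M := M)).rTensor (V ⊗[k] W)

/-- `g ⊗ m ↦ m ⊗ f(g) v ⊗ w`. -/
def twistAux (f : H →ₗ[k] H) {W : Type u} [AddCommGroup W] [Module k W] (v : V) (w : W) :
    H ⊗[k] M →ₗ[k] M ⊗[k] (V ⊗[k] W) :=
  (TensorProduct.leftComm k V M W).toLinearMap ∘ₗ
    TensorProduct.map ((leftAct k H V).flip v ∘ₗ f) ((TensorProduct.mk k M W).flip w)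

theorem twistAux_tmul (f : H →ₗ[k] H) {W : Type u} [AddCommGroup W] [Module k W] (v : V) (w : W)
    (g : H) (m : M) :
    twistAux f v w (g ⊗ₜ[k] m) = m ⊗ₜ[k] (leftAct k H V (f g) v ⊗ₜ[k] w) := by
  simp [twistAux]

theorem twist_tmul (f : H →ₗ[k] H) {W : Type u} [AddCommGroup W] [Module k W] (m : M) (v : V)
    (w : W) :
    twist f W (m ⊗ₜ[k] (v ⊗ₜ[k] w)) =
      twistAux f v w (SAYDModule.coact (k := k) (H := H) m) := by
  simp only [twist, LinearMap.comp_apply, LinearMap.rTensor_tmul]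
  generalize SAYDModule.coact (k := k) (H := H) m = y
  induction y using TensorProduct.induction_on with
  | zero => simp
  | add x y hx hy => simp only [map_add, TensorProduct.add_tmul, hx, hy]
  | tmul g m => simp [twistAux]

/-- `m ⊗ v₀ ⊗ ⋯ ⊗ vₙ ↦ m₍₀₎ ⊗ v₁ ⊗ ⋯ ⊗ vₙ ⊗ m₍₋₁₎ v₀`. -/
def rotateC (n : ℕ) : M ⊗[k] TPow k V (n + 1) →ₗ[k] M ⊗[k] TPow k V (n + 1) :=
  ((TPow.cons n).toLinearMap ∘ₗ firstLast n).lTensor M ∘ₗ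
    twist (LinearMap.id : H →ₗ[k] H) (TPow k V n) ∘ₗ (TPow.cons n).symm.toLinearMap.lTensor M

theorem rotateC_tmul (n : ℕ) (m : M) (v : V) (w : TPow k V n) :
    rotateC (H := H) n (m ⊗ₜ[k] TPow.cons n (v ⊗ₜ[k] w)) =
      ((TPow.cons n).toLinearMap ∘ₗ firstLast n).lTensor M
        (twistAux LinearMap.id v w (SAYDModule.coact (k := k) (H := H) m)) := by
  simp only [rotateC, LinearMap.comp_apply, LinearMap.lTensor_tmul, LinearEquiv.coe_coe,
    LinearEquiv.symm_apply_apply, twist_tmul]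

theorem rotateC_aux (n : ℕ) (m : M) (u : V) (w : TPow k V n) (y : H) :
    ∑ j ∈ (ℛ k y).index, (balancedRel M (diag (H := H) V (n + 1))).mkQ
        (rightAct k H M ((ℛ k y).left j) m ⊗ₜ[k] TPow.cons n
          (firstLast n (leftAct k H V (antipode k ((ℛ k y).right j)) u ⊗ₜ[k] w))) =
      (balancedRel M (diag (H := H) V (n + 1))).mkQ
        (m ⊗ₜ[k] TPow.cons n (firstLast n (u ⊗ₜ[k] diag V n y w))) := by
  have key := congrArg ((balancedRel M (diag (H := H) V (n + 1))).mkQ ∘ₗ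
      TensorProduct.mk k M (TPow k V (n + 1)) m ∘ₗ (TPow.cons n).toLinearMap ∘ₗ firstLast n ∘ₗ
      (TensorProduct.comm k _ _).toLinearMap ∘ₗ
      ((leftAct k H V).flip u ∘ₗ LinearMap.mul' k H ∘ₗ
        (antipode k (A := H)).lTensor H).lTensor (TPow k V n))
    (sum_coassoc ((diag V n).flip w) (LinearMap.id : H →ₗ[k] H) LinearMap.id y)
  have e := congrArg ((balancedRel M (diag (H := H) V (n + 1))).mkQ ∘ₗ
      TensorProduct.mk k M (TPow k V (n + 1)) m ∘ₗ (TPow.cons n).toLinearMap ∘ₗ firstLast n ∘ₗ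
      (TensorProduct.comm k _ _).toLinearMap)
    (sum_map_counit_smul ((diag V n).flip w) u y)
  have hS : ∀ z : H, ∑ j ∈ (ℛ k z).index,
      leftAct k H V ((ℛ k z).left j * antipode k ((ℛ k z).right j)) u = (counit z : k) • u := by
    intro z
    rw [← LinearMap.sum_apply, ← map_sum, sum_mul_antipode_eq_smul, map_smul]
    simp [leftAct]
  have hmul : ∀ a b : H, leftAct k H V a (leftAct k H V b u) = leftAct k H V (a * b) u := by
    intro a b
    simp [leftAct]
  simp only [map_sum, LinearMap.lTensor_tmul, LinearMap.comp_apply, LinearEquiv.coe_coe,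
    LinearMap.flip_apply, LinearMap.id_apply, LinearMap.mul'_apply, TensorProduct.comm_tmul,
    TensorProduct.mk_apply] at key e
  rw [← e]
  simp only [balanced_eq, diag_cons, firstLast_act, tensorAct_apply _ _ (ℛ k _), map_sum,
    TensorProduct.comm_tmul, TensorProduct.tmul_sum, hmul]
  refine key.trans (Finset.sum_congr rfl fun i _ => ?_)
  rw [← hS]
  simp only [map_sum, TensorProduct.sum_tmul, TensorProduct.tmul_sum]

theorem rotateC_balanced (n : ℕ) (m : M) (h : H) (w : TPow k V (n + 1)) :
    (balancedRel M (diag (H := H) V (n + 1))).mkQ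
        (rotateC (H := H) n (rightAct k H M h m ⊗ₜ[k] w)) =
      (balancedRel M (diag (H := H) V (n + 1))).mkQ
        (rotateC (H := H) n (m ⊗ₜ[k] diag V (n + 1) h w)) := by
  obtain ⟨z, rfl⟩ := (TPow.cons n).surjective w
  induction z using TensorProduct.induction_on with
  | zero => simp
  | add x y hx hy => simp only [map_add, TensorProduct.tmul_add, hx, hy]
  | tmul v w =>
    simp only [diag_cons, tensorAct_apply _ _ (ℛ k h), map_sum, TensorProduct.tmul_sum,
      rotateC_tmul, SAYDModule.anti_yetter_drinfeld]
    generalize SAYDModule.coact (k := k) (H := H) m = y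
    refine Finset.sum_congr rfl fun i _ => ?_
    induction y using TensorProduct.induction_on with
    | zero => simp
    | add x y hx hy => simp only [map_add, Finset.sum_add_distrib, hx, hy]
    | tmul g m =>
      have hmul : ∀ a b c : H, leftAct k H V (a * (b * c)) v =
          leftAct k H V a (leftAct k H V (b * c) v) := by
        intro a b c
        simp [leftAct, mul_smul]
      have hmul' : ∀ b c : H, leftAct k H V b (leftAct k H V c v) =
          leftAct k H V (b * c) v := by
        intro b c
        simp [leftAct, mul_smul]
      simp only [TensorProduct.map_tmul, twistAux_tmul, LinearMap.lTensor_tmul,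
        LinearMap.comp_apply, LinearEquiv.coe_coe, LinearMap.mulLeft_apply,
        LinearMap.mulRight_apply, LinearMap.id_apply, hmul, rotateC_aux]
      simp only [hmul']

variable [BijectiveAntipode k H]

/-- `m ⊗ v₀ ⊗ ⋯ ⊗ vₙ ↦ m₍₀₎ ⊗ S⁻¹(m₍₋₁₎) vₙ ⊗ v₀ ⊗ ⋯ ⊗ vₙ₋₁`. -/
def rotateA (n : ℕ) : M ⊗[k] TPow k V (n + 1) →ₗ[k] M ⊗[k] TPow k V (n + 1) :=
  (TPow.cons n).toLinearMap.lTensor M ∘ₗ twist (antipodeInv k H) (TPow k V n) ∘ₗ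
    (lastFirst n ∘ₗ (TPow.cons n).symm.toLinearMap).lTensor M

variable (k) in
theorem antipode_antipodeInv (x : H) : antipode k (antipodeInv k H x) = x :=
  (LinearEquiv.ofBijective (antipode k (A := H)) BijectiveAntipode.bijective).apply_symm_apply x

variable (k) in
theorem antipodeInv_mul (x y : H) :
    antipodeInv k H (x * y) = antipodeInv k H y * antipodeInv k H x := by
  apply (BijectiveAntipode.bijective (k := k) (H := H)).injective
  rw [antipode_mul_antidistrib]
  simp only [antipode_antipodeInv]

variable (k) in
theorem antipodeInv_antipode (x : H) : antipodeInv k H (antipode k x) = x :=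
  (LinearEquiv.ofBijective (antipode k (A := H)) BijectiveAntipode.bijective).symm_apply_apply x

theorem sum_mul_antipodeInv (h : H) :
    ∑ i ∈ (ℛ k h).index, (ℛ k h).right i * antipodeInv k H ((ℛ k h).left i) =
      (counit h : k) • (1 : H) := by
  apply (BijectiveAntipode.bijective (k := k) (H := H)).injective
  simp only [map_sum, antipode_mul_antidistrib, antipode_antipodeInv, map_smul, antipode_one,
    sum_mul_antipode_eq_smul]

theorem rotateA_aux (n : ℕ) (m : M) (u : V) (w : TPow k V n) (x : H) :
    ∑ j ∈ (ℛ k x).index, (balancedRel M (diag (H := H) V (n + 1))).mkQ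
        (rightAct k H M ((ℛ k x).right j) m ⊗ₜ[k] TPow.cons n
          (leftAct k H V (antipodeInv k H ((ℛ k x).left j)) u ⊗ₜ[k] w)) =
      (balancedRel M (diag (H := H) V (n + 1))).mkQ
        (m ⊗ₜ[k] TPow.cons n (u ⊗ₜ[k] diag V n x w)) := by
  have key := congrArg ((balancedRel M (diag (H := H) V (n + 1))).mkQ ∘ₗ
      TensorProduct.mk k M (TPow k V (n + 1)) m ∘ₗ (TPow.cons n).toLinearMap ∘ₗ
      ((leftAct k H V).flip u ∘ₗ LinearMap.mul' k H ∘ₗ (TensorProduct.comm k H H).toLinearMap ∘ₗ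
        (antipodeInv k H).rTensor H).rTensor (TPow k V n) ∘ₗ
        (TensorProduct.assoc k H H (TPow k V n)).symm.toLinearMap)
    (sum_coassoc (LinearMap.id : H →ₗ[k] H) LinearMap.id ((diag V n).flip w) x)
  have e := congrArg ((balancedRel M (diag (H := H) V (n + 1))).mkQ ∘ₗ
      TensorProduct.mk k M (TPow k V (n + 1)) m ∘ₗ (TPow.cons n).toLinearMap)
    (sum_counit_smul_map ((diag V n).flip w) u x)
  have hS : ∀ z : H, ∑ j ∈ (ℛ k z).index,
      leftAct k H V ((ℛ k z).right j * antipodeInv k H ((ℛ k z).left j)) u =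
        (counit z : k) • u := by
    intro z
    rw [← LinearMap.sum_apply, ← map_sum, sum_mul_antipodeInv, map_smul]
    simp [leftAct]
  have hmul : ∀ a b : H, leftAct k H V a (leftAct k H V b u) = leftAct k H V (a * b) u := by
    intro a b
    simp [leftAct]
  simp only [map_sum, LinearMap.rTensor_tmul, LinearMap.comp_apply, LinearEquiv.coe_coe,
    LinearMap.flip_apply, LinearMap.id_apply, LinearMap.mul'_apply, TensorProduct.comm_tmul,
    TensorProduct.assoc_symm_tmul, TensorProduct.mk_apply] at key e
  rw [← e]
  simp only [balanced_eq, diag_cons, tensorAct_apply _ _ (ℛ k _), map_sum,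
    TensorProduct.tmul_sum, hmul]
  refine key.symm.trans (Finset.sum_congr rfl fun i _ => ?_)
  rw [← hS]
  simp only [map_sum, TensorProduct.sum_tmul, TensorProduct.tmul_sum]

theorem rotateA_balanced (n : ℕ) (m : M) (h : H) (w : TPow k V (n + 1)) :
    (balancedRel M (diag (H := H) V (n + 1))).mkQ
        (rotateA (H := H) n (rightAct k H M h m ⊗ₜ[k] w)) =
      (balancedRel M (diag (H := H) V (n + 1))).mkQ
        (rotateA (H := H) n (m ⊗ₜ[k] diag V (n + 1) h w)) := by
  obtain ⟨z, rfl⟩ := (TPow.cons n).surjective w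
  simp only [rotateA, LinearMap.comp_apply, LinearMap.lTensor_tmul, LinearEquiv.coe_coe,
    LinearEquiv.symm_apply_apply, diag_cons, lastFirst_act]
  generalize lastFirst n z = y
  induction y using TensorProduct.induction_on with
  | zero => simp
  | add x y hx hy => simp only [map_add, TensorProduct.tmul_add, hx, hy]
  | tmul a w =>
    simp only [tensorAct_apply _ _ (ℛ k h), map_sum, TensorProduct.tmul_sum,
      TensorProduct.comm_tmul, twist_tmul, SAYDModule.anti_yetter_drinfeld]
    generalize SAYDModule.coact (k := k) (H := H) m = y
    induction y using TensorProduct.induction_on with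
    | zero => simp
    | add x y hx hy => simp only [map_add, Finset.sum_add_distrib, hx, hy]
    | tmul g m =>
      have hmul : ∀ x b q : H, leftAct k H V (x * b * q) a =
          leftAct k H V x (leftAct k H V (b * q) a) := by
        intro x b q
        simp [leftAct, mul_smul]
      have hmul' : ∀ b c : H, leftAct k H V b (leftAct k H V c a) =
          leftAct k H V (b * c) a := by
        intro b c
        simp [leftAct, mul_smul]
      have key := congrArg ((balancedRel M (diag (H := H) V (n + 1))).mkQ ∘ₗ
          ((TPow.cons n).toLinearMap ∘ₗ (TensorProduct.mk k V (TPow k V n)).flip w ∘ₗ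
            TensorProduct.lift (LinearMap.id : (V →ₗ[k] V) →ₗ[k] V →ₗ[k] V)).lTensor M ∘ₗ
          (TensorProduct.leftComm k (V →ₗ[k] V) M V).toLinearMap)
        (sum_coassoc (leftAct k H V ∘ₗ antipodeInv k H) ((rightAct k H M).flip m)
          ((leftAct k H V).flip a ∘ₗ LinearMap.mulLeft k (antipodeInv k H g)) h)
      simp only [map_sum, LinearMap.lTensor_tmul, LinearMap.comp_apply, LinearEquiv.coe_coe,
        LinearMap.flip_apply, LinearMap.id_apply, TensorProduct.leftComm_tmul,
        TensorProduct.mk_apply, TensorProduct.lift.tmul, LinearMap.mulLeft_apply,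
        rotateA_aux] at key
      simp only [TensorProduct.map_tmul, twistAux_tmul, LinearMap.lTensor_tmul,
        LinearMap.comp_apply, LinearEquiv.coe_coe, LinearMap.mulLeft_apply,
        LinearMap.mulRight_apply, antipodeInv_mul, antipodeInv_antipode, hmul, hmul']
      simp only [hmul'] at key
      refine Eq.trans ?_ key.symm
      simp only [hmul', mul_assoc]

end Twist

end Equivariance

/-! ### The cocyclic modules `C_H(C, M)`, `C_H(A, M)`, `C(A)` and the Janus map -/

section Objects

variable (k)

/-- The cocyclic module `C_H^n(C, M) = M ⊗_H C^{⊗ (n+1)}` of an `H`-module coalgebra `C`: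
`d_i` applies `Δ` to `cⁱ` for `i ≤ n`, the last coface is
`m ⊗ c⁰ ⊗ ⋯ ⊗ cⁿ ↦ m₍₀₎ ⊗ c⁰₍₂₎ ⊗ c¹ ⊗ ⋯ ⊗ cⁿ ⊗ m₍₋₁₎ c⁰₍₁₎`, i.e. `t d_0`, the codegeneracy `s_j`
applies `ε` to `cʲ⁺¹`, and `t (m ⊗ c⁰ ⊗ ⋯ ⊗ cⁿ) = m₍₀₎ ⊗ c¹ ⊗ ⋯ ⊗ cⁿ ⊗ m₍₋₁₎ c⁰`. -/
def coalgebraCocyclic (H C M : Type u) [Ring H] [HopfAlgebra k H]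
    [AddCommGroup C] [Module k C] [Coalgebra k C] [Module H C] [IsScalarTower k H C]
    [ModuleCoalgebra k H C]
    [AddCommGroup M] [Module k M] [Module Hᵐᵒᵖ M] [IsScalarTower k Hᵐᵒᵖ M] [SAYDModule k H M] :
    CocyclicData k :=
  let t : ∀ n : ℕ, Balanced M (diag (H := H) C (n + 1)) →ₗ[k]
      Balanced M (diag (H := H) C (n + 1)) := fun n =>
    balancedLift _ ((balancedRel M (diag (H := H) C (n + 1))).mkQ ∘ₗ rotateC n)
      (rotateC_balanced n)
  let d : ∀ n : ℕ, Fin (n + 1) → (Balanced M (diag (H := H) C (n + 1)) →ₗ[k]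
      Balanced M (diag (H := H) C (n + 2))) := fun n i =>
    balancedMap (comulAt (n + 1) i) (comulAt_equivariant (n + 1) i)
  { obj := fun n => ModuleCat.of k (Balanced M (diag (H := H) C (n + 1)))
    d := fun n => Fin.lastCases (t (n + 1) ∘ₗ d n 0) (d n)
    s := fun n j => balancedMap (counitAt (n + 1) j.succ) (counitAt_equivariant (n + 1) j.succ)
    t := t }

/-- The cocyclic module `C_H^n(A, M) = Hom_k(M ⊗_H A^{⊗ (n+1)}, k)` of an `H`-module algebra `A`:
`d_i` for `i ≤ n` is the transpose of the multiplication of `aᵢ` and `aᵢ₊₁`, the last coface is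
`φ ↦ φ(m₍₀₎ ⊗ (S⁻¹(m₍₋₁₎) aₙ₊₁) a₀ ⊗ a₁ ⊗ ⋯ ⊗ aₙ)`, i.e. `t d_0`, the codegeneracy `s_j` is the
transpose of the insertion of `1` after `aⱼ`, and
`(t φ)(m ⊗ a₀ ⊗ ⋯ ⊗ aₙ) = φ(m₍₀₎ ⊗ S⁻¹(m₍₋₁₎) aₙ ⊗ a₀ ⊗ ⋯ ⊗ aₙ₋₁)`. -/
def algebraCocyclic (H A M : Type u) [Ring H] [HopfAlgebra k H] [BijectiveAntipode k H]
    [Ring A] [Algebra k A] [Module H A] [IsScalarTower k H A] [ModuleAlgebra k H A]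
    [AddCommGroup M] [Module k M] [Module Hᵐᵒᵖ M] [IsScalarTower k Hᵐᵒᵖ M] [SAYDModule k H M] :
    CocyclicData k :=
  let t : ∀ n : ℕ, Balanced M (diag (H := H) A (n + 1)) →ₗ[k]
      Balanced M (diag (H := H) A (n + 1)) := fun n =>
    balancedLift _ ((balancedRel M (diag (H := H) A (n + 1))).mkQ ∘ₗ rotateA n)
      (rotateA_balanced n)
  let d : ∀ n : ℕ, Fin (n + 1) → (Balanced M (diag (H := H) A (n + 2)) →ₗ[k]
      Balanced M (diag (H := H) A (n + 1))) := fun n i =>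
    balancedMap (mulAt (n + 1) i) (mulAt_equivariant (n + 1) i)
  { obj := fun n => ModuleCat.of k (Module.Dual k (Balanced M (diag (H := H) A (n + 1))))
    d := fun n => Fin.lastCases ((d n 0 ∘ₗ t (n + 1)).dualMap) (fun i => (d n i).dualMap)
    s := fun n j => (balancedMap (M := M) (unitAt (n + 1) j.succ)
      (unitAt_equivariant (H := H) (n + 1) j.succ)).dualMap
    t := fun n => (t n).dualMap }

/-- The cocyclic module `C^n(A) = Hom_k(A^{⊗ (n+1)}, k)` of an algebra `A`. -/
def ordinaryCocyclic (A : Type u) [Ring A] [Algebra k A] : CocyclicData k :=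
  let t : ∀ n : ℕ, TPow k A (n + 1) →ₗ[k] TPow k A (n + 1) := fun n =>
    (TPow.cons n).toLinearMap ∘ₗ lastFirst n ∘ₗ (TPow.cons n).symm.toLinearMap
  { obj := fun n => ModuleCat.of k (Module.Dual k (TPow k A (n + 1)))
    d := fun n => Fin.lastCases ((mulAt (n + 1) 0 ∘ₗ t (n + 1)).dualMap)
      (fun i => (mulAt (n + 1) i).dualMap)
    s := fun n j => (unitAt (n + 1) j.succ).dualMap
    t := fun n => (t n).dualMap }

variable {k} {C A : Type u} [AddCommGroup C] [Module k C] [Coalgebra k C] [Module H C]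
  [IsScalarTower k H C] [Ring A] [Algebra k A] [Module H A] [IsScalarTower k H A]

/-- `(c⁰ ⊗ ⋯ ⊗ cⁿ⁻¹) ⊗ (a₀ ⊗ ⋯ ⊗ aₙ₋₁) ↦ c⁰ a₀ ⊗ ⋯ ⊗ cⁿ⁻¹ aₙ₋₁`. -/
def actAt (ρ : C →ₗ[k] A →ₗ[k] A) : (n : ℕ) → (TPow k C n →ₗ[k] TPow k A n →ₗ[k] TPow k A n)
  | 0 => (LinearMap.toSpanSingleton k (TPow k A 0 →ₗ[k] TPow k A 0) LinearMap.id) ∘ₗ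
      TPow.nil.symm.toLinearMap
  | n + 1 => (TPow.cons n).conj.toLinearMap ∘ₗ TensorProduct.map₂ ρ (actAt ρ n) ∘ₗ
      (TPow.cons n).symm.toLinearMap

theorem actAt_diag (ρ : EquivariantAction k H C A) (n : ℕ) (h : H) (w : TPow k C n)
    (u : TPow k A n) :
    actAt ρ.act n (diag C n h w) u = diag A n h (actAt ρ.act n w u) := by
  induction n generalizing h with
  | zero =>
    simp only [actAt, diag_zero, LinearMap.comp_apply, LinearMap.toSpanSingleton_apply,
      LinearEquiv.coe_coe, map_smul, LinearMap.smul_apply, LinearMap.id_apply]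
    exact smul_comm _ _ _
  | succ n ih =>
    obtain ⟨z, rfl⟩ := (TPow.cons n).surjective w
    obtain ⟨y, rfl⟩ := (TPow.cons n).surjective u
    induction z using TensorProduct.induction_on with
    | zero => simp
    | add x y hx hy => simp only [map_add, LinearMap.add_apply, hx, hy]
    | tmul c w =>
      induction y using TensorProduct.induction_on with
      | zero => simp
      | add x y hx hy => simp only [map_add, hx, hy]
      | tmul a u =>
        have e : ∀ (c : C) (w : TPow k C n), actAt ρ.act (n + 1) (TPow.cons n (c ⊗ₜ[k] w))
            (TPow.cons n (a ⊗ₜ[k] u)) = TPow.cons n (ρ.act c a ⊗ₜ[k] actAt ρ.act n w u) := by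
          intro c w
          simp [actAt, LinearEquiv.conj_apply]
        have hρ : ∀ g : H, ρ.act (leftAct k H C g c) a = leftAct k H A g (ρ.act c a) :=
          fun g => (ρ.smul_act g c a).symm
        simp only [diag_cons, tensorAct_apply _ _ (ℛ k h), map_sum, LinearMap.sum_apply, e, ih, hρ]

variable (M : Type u) [AddCommGroup M] [Module k M] [Module Hᵐᵒᵖ M] [IsScalarTower k Hᵐᵒᵖ M]

/-- `(m ⊗_H c) ⊗ a ↦ m ⊗_H c a`, as a map
`M ⊗_H C^{⊗ n} → Hom(A^{⊗ n}, M ⊗_H A^{⊗ n})`. -/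
def balancedAct (ρ : EquivariantAction k H C A) (n : ℕ) :
    Balanced M (diag (k := k) (H := H) C n) →ₗ[k] TPow k A n →ₗ[k]
      Balanced M (diag (k := k) (H := H) A n) :=
  balancedLift _
    (TensorProduct.lift (LinearMap.mk₂ k
      (fun (m : M) (w : TPow k C n) => (balancedRel M (diag (H := H) A n)).mkQ ∘ₗ
        TensorProduct.mk k M (TPow k A n) m ∘ₗ actAt ρ.act n w)
      (fun m m' w => by ext a; simp [TensorProduct.add_tmul])
      (fun c m w => by ext a; simp)
      (fun m w w' => by ext a; simp [TensorProduct.tmul_add])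
      (fun c m w => by ext a; simp)))
    (by
      intro m h w
      ext a
      simp only [TensorProduct.lift.tmul, LinearMap.mk₂_apply, LinearMap.comp_apply,
        TensorProduct.mk_apply, actAt_diag, balanced_eq])

/-- `x ⊗ φ ↦ (a ↦ φ(x a))`. -/
def janusAux (ρ : EquivariantAction k H C A) (n : ℕ) :
    Balanced M (diag (k := k) (H := H) C n) →ₗ[k]
      Module.Dual k (Balanced M (diag (k := k) (H := H) A n)) →ₗ[k] Module.Dual k (TPow k A n) :=
  LinearMap.mk₂ k (fun x φ => φ ∘ₗ balancedAct M ρ n x)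
    (fun x x' φ => by ext a; simp)
    (fun c x φ => by ext a; simp)
    (fun x φ φ' => by ext a; simp)
    (fun c x φ => by ext a; simp)

/-- The Janus map `C_H^n(C, M) ⊗ C_H^n(A, M) → C^n(A)`,
`(m ⊗_H c⁰ ⊗ ⋯ ⊗ cⁿ) ⊗ φ ↦ (a₀ ⊗ ⋯ ⊗ aₙ ↦ φ(m ⊗_H c⁰ a₀ ⊗ ⋯ ⊗ cⁿ aₙ))`. -/
def janus [BijectiveAntipode k H] [ModuleCoalgebra k H C] [ModuleAlgebra k H A]
    [SAYDModule k H M] (ρ : EquivariantAction k H C A) (n : ℕ) :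
    (coalgebraCocyclic k H C M).obj n →ₗ[k] (algebraCocyclic k H A M).obj n →ₗ[k]
      (ordinaryCocyclic k A).obj n :=
  janusAux M ρ (n + 1)

end Objects

/-! ### The dual cyclic theory of an algebra -/

section Point

variable (A : Type u) [Ring A] [Algebra k A]

/-- Evaluation of a cochain in `C^0(A) = Hom(A, k)` at `1`. -/
def evalOne : (ordinaryCocyclic k A).dual.obj 0 →ₗ[k] k :=
  LinearMap.applyₗ (R := k) (M₂ := k) (TPow.cons 0 ((1 : A) ⊗ₜ[k] TPow.nil (1 : k)))

theorem evalOne_face (i : Fin 2) (f : Module.Dual k (TPow k A 2)) :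
    evalOne A ((ordinaryCocyclic k A).dual.face 0 i f) =
      f (TPow.cons 1 ((1 : A) ⊗ₜ[k] TPow.cons 0 ((1 : A) ⊗ₜ[k] TPow.nil (1 : k)))) := by
  have h1 : unitAt (k := k) (A := A) 1 1
      (TPow.cons 0 ((1 : A) ⊗ₜ[k] TPow.nil (1 : k))) =
      TPow.cons 1 ((1 : A) ⊗ₜ[k] TPow.cons 0 ((1 : A) ⊗ₜ[k] TPow.nil (1 : k))) := by
    change underCons (unitAt 0 0) _ = _
    simp [underCons, unitAt]
  have h2 : lastFirst 1 ((1 : A) ⊗ₜ[k] TPow.cons 0 ((1 : A) ⊗ₜ[k] TPow.nil (1 : k))) =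
      (1 : A) ⊗ₜ[k] TPow.cons 0 ((1 : A) ⊗ₜ[k] TPow.nil (1 : k)) := by
    simp [lastFirst_succ, lastFirst]
  match i with
  | 0 =>
    change f (unitAt 1 1 _) = _
    rw [h1]
  | 1 =>
    change f (((TPow.cons 1).toLinearMap ∘ₗ lastFirst 1 ∘ₗ
      (TPow.cons 1).symm.toLinearMap) (unitAt 1 1 _)) = _
    rw [h1]
    simp only [LinearMap.comp_apply, LinearEquiv.coe_coe, LinearEquiv.symm_apply_apply, h2]

/-- The canonical functional on `°HC^p(A)`: for even `p` it sends the class of a cycle of the total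
complex to the value at `1` of its component in `C^0(A)`; for odd `p` it is zero. -/
def pointFunctional (p : ℕ) : DualHC (ordinaryCocyclic k A) p →ₗ[k] k :=
  ((ordinaryCocyclic k A).dual.boundaries p).liftQ
    (if Even p then
      evalOne A ∘ₗ LinearMap.proj (R := k)
        (φ := fun j : Fin (p + 1) => (ordinaryCocyclic k A).dual.obj j) 0 ∘ₗ
        ((ordinaryCocyclic k A).dual.cycles p).subtype
    else 0) (by
    rintro ⟨z, hz⟩ ⟨y, hy⟩
    have hy' : (ordinaryCocyclic k A).dual.D p y = z := hy
    rw [LinearMap.mem_ker]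
    by_cases e : Even p
    · rw [if_pos e]
      have h0 := (ordinaryCocyclic k A).dual.D_zero_apply_eq_zero (evalOne A)
        (fun v => (evalOne_face A 0 v).trans (evalOne_face A 1 v).symm) (pow_zero _) p e y
      rw [hy'] at h0
      exact h0
    · rw [if_neg e, LinearMap.zero_apply])

end Point

end Hopf

end

end HopfCyclic

/-! The Janus map commutes with the structure maps slot by slot. The cofaces reduce to `c(ab) =
(c₍₁₎a)(c₍₂₎b)`, the codegeneracies to `c1 = ε(c)1`, and both statements descend to `M ⊗_H -`
(`balancedAct_natural`). The rotation of the factors from `C` is inverse to that of the factors from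
`A`, so only the twists remain to be compared. By `h(ca) = (hc)a` they combine to `S⁻¹(m₍₋₁₎)
m₍₋₂₎`, which coassociativity and the antipode collapse to the counit (`twist_antipodeInv_twistAux`,
`balancedAct_rotate`). The last coface is `t d₀` in all three modules and needs no separate
argument.

In the cyclic dual of `C(A)` the faces insert units. A functional `χ` on `A` with `χ(1) = 1`, which
exists because `A ≠ 0`, removes a unit again, so `(hφ)(a₀, …, aₙ₊₁) = χ(a₁) φ(a₀, a₂, …)` is an
extra degeneracy. It contracts the `b'`-columns of Tsygan's bicomplex and contracts the `b`-columns
onto `k` in row zero. Concretely, `D y = z` is solved row by row, with `y₀` free: each row is solved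
by applying `h`, and the remainder vanishes by the previous row, the cycle condition and the
identities `b(1 - T) = (1 - T)b'`, `b'N = Nb`. The only obstruction is the value of `z₀` at `1`, in
even total degree (`IsContraction.exists_D_eq`). With `y₀ = 0` this shows that `κ` is injective and
that odd degrees vanish; with `z = 0` and `y₀ = χ` it produces cycles on which `κ` takes the value
`1`.

The pairing is then formal. Since `κ` is compatible with periodicity, the conditions on `μ` force
`β₀ = κ₀ J₀`, `β₁ = 0` and `β_{p+2}(ξ, η) = β_p(Sξ, Sη)`, which gives uniqueness. Conversely this
recursion defines `β`, and `μ_p = κ_p⁻¹ β_p` in even degrees, `μ_p = 0` in odd degrees, is an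
induced product (`existsUnique_pairing`). What has to be checked is that the value at `1` of `J₀`
vanishes on Hochschild boundaries in either argument. At the unit all actions become counits, and
`ε(m₍₋₁₎) m₍₀₎ = m` makes the two faces agree (`janus_dual_b_left`, `janus_dual_b_right`). -/

namespace HopfCyclic

noncomputable section

/-! ### The bicomplex of a cyclic module with a contraction -/

namespace CyclicData

variable {k : Type u} [Field k]

/-- The identities of a cyclic module that make Tsygan's bicomplex a bicomplex. -/
structure IsCyclic (F : CyclicData k) : Prop where
  t_pow : ∀ n, F.t n ^ (n + 1) = 1
  face_last : ∀ n, F.face n (Fin.last (n + 1)) = F.face n 0 ∘ₗ F.t (n + 1)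
  face_succ : ∀ n (j : Fin n),
    F.face n j.succ.castSucc ∘ₗ F.t (n + 1) = F.t n ∘ₗ F.face n j.castSucc.castSucc

/-- An extra degeneracy `h` of the underlying simplicial module, with augmentation `e` and
base point `χ`. -/
structure IsContraction (F : CyclicData k) (h : ∀ n, F.obj n →ₗ[k] F.obj (n + 1))
    (e : F.obj 0 →ₗ[k] k) (χ : F.obj 0) : Prop where
  face_zero : ∀ n v, F.face n 0 (h n v) = v
  face_succ : ∀ n (i : Fin (n + 2)) v, F.face (n + 1) i.succ (h (n + 1) v) = h n (F.face n i v)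
  face_one : ∀ v, F.face 0 1 (h 0 v) = e v • χ

variable {F : CyclicData k}

/-! ### Commutation of `b` and `b'` with `1 - T` and the norm, where `T` is the signed cyclic
operator. -/

namespace IsCyclic

variable (hF : F.IsCyclic)
include hF

theorem signedT_pow (n : ℕ) : F.signedT n ^ (n + 1) = 1 := by
  rw [signedT, smul_pow, hF.t_pow, ← pow_mul, (Nat.even_mul_succ_self n).neg_one_pow, one_smul]

theorem norm_signedT (n : ℕ) (v : F.obj n) : F.norm n (F.signedT n v) = F.norm n v := by
  have h : F.norm n * (F.signedT n - 1) = 0 := by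
    rw [norm, geom_sum_mul, hF.signedT_pow, sub_self]
  have := LinearMap.congr_fun h v
  simpa [sub_eq_zero] using this

theorem signedT_norm (n : ℕ) (v : F.obj n) : F.signedT n (F.norm n v) = F.norm n v := by
  have h : (F.signedT n - 1) * F.norm n = 0 := by
    rw [norm, mul_geom_sum, hF.signedT_pow, sub_self]
  have := LinearMap.congr_fun h v
  simpa [sub_eq_zero] using this

theorem norm_signedT_pow (n i : ℕ) (v : F.obj n) :
    F.norm n ((F.signedT n ^ i) v) = F.norm n v := by
  induction i with
  | zero => simp
  | succ i ih => rw [pow_succ', Module.End.mul_apply, hF.norm_signedT, ih]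

theorem signedFace_succ (n : ℕ) (j : Fin n) (v : F.obj (n + 1)) :
    (-1 : k) ^ (j.succ.castSucc : ℕ) • F.face n j.succ.castSucc (F.signedT (n + 1) v) =
      F.signedT n ((-1 : k) ^ (j.castSucc.castSucc : ℕ) • F.face n j.castSucc.castSucc v) := by
  have := LinearMap.congr_fun (hF.face_succ n j) v
  simp only [LinearMap.comp_apply] at this
  simp only [signedT, LinearMap.smul_apply, map_smul, this, smul_smul, Fin.val_castSucc,
    Fin.val_succ]
  congr 1
  ring

theorem signedFace_last (n : ℕ) (v : F.obj (n + 1)) :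
    (-1 : k) ^ (n + 1) • F.face n (Fin.last (n + 1)) v = F.face n 0 (F.signedT (n + 1) v) := by
  simp [signedT, hF.face_last]

/-- Each application of `signedFace_succ` trades a `T` on the right and one step of the face index
for a `T` on the left. -/
theorem signedFace_pow (n i : ℕ) (hi : i < n + 1) (v : F.obj (n + 1)) :
    (-1 : k) ^ i • F.face n (⟨i, hi⟩ : Fin (n + 1)).castSucc ((F.signedT (n + 1) ^ i) v) =
      (F.signedT n ^ i) (F.face n 0 v) := by
  induction i with
  | zero => simp
  | succ i ih =>
    rw [pow_succ' (F.signedT (n + 1)), Module.End.mul_apply, pow_succ' (F.signedT n),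
      Module.End.mul_apply, ← ih (by omega)]
    exact hF.signedFace_succ n ⟨i, by omega⟩ _

theorem signedFace_eq (n i : ℕ) (hi : i < n + 1) (v : F.obj (n + 1)) :
    (-1 : k) ^ i • F.face n (⟨i, hi⟩ : Fin (n + 1)).castSucc v =
      (F.signedT n ^ i) (F.face n 0 ((F.signedT (n + 1) ^ (n + 2 - i)) v)) := by
  rw [← hF.signedFace_pow n i hi, ← Module.End.mul_apply, ← pow_add,
    show i + (n + 2 - i) = n + 1 + 1 by omega, hF.signedT_pow, Module.End.one_apply]

/-- Since `T` has finite order, every signed face is `∂₀` between powers of `T`. In this form the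
commutation identities become shifts of a summation index, and no simplicial identity is needed. -/
theorem b'_eq (n : ℕ) (v : F.obj (n + 1)) :
    F.b' n v = ∑ i ∈ Finset.range (n + 1),
      (F.signedT n ^ i) (F.face n 0 ((F.signedT (n + 1) ^ (n + 2 - i)) v)) := by
  rw [Finset.sum_range, b', LinearMap.sum_apply]
  exact Finset.sum_congr rfl fun i _ => hF.signedFace_eq n i i.2 v

omit hF in
theorem b_eq_b'_add (n : ℕ) (v : F.obj (n + 1)) :
    F.b n v = F.b' n v + (-1 : k) ^ (n + 1) • F.face n (Fin.last (n + 1)) v := by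
  simp only [b, b', LinearMap.sum_apply, LinearMap.smul_apply]
  rw [Fin.sum_univ_castSucc]
  rfl

/-- The last signed face `∂₀ T` fits the pattern at `i = n + 1`, because `T ^ (n + 1) = 1` in degree
`n`. -/
theorem b_eq (n : ℕ) (v : F.obj (n + 1)) :
    F.b n v = ∑ i ∈ Finset.range (n + 2),
      (F.signedT n ^ i) (F.face n 0 ((F.signedT (n + 1) ^ (n + 2 - i)) v)) := by
  rw [Finset.sum_range_succ, ← hF.b'_eq, b_eq_b'_add, hF.signedFace_last, hF.signedT_pow,
    show n + 2 - (n + 1) = 1 by omega]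
  simp

/-- Precomposing the sum for `b` with `T` shifts its index: the term `i = 0` becomes `∂₀ T`, the
signed last face, and the remaining terms form `T b'`. Subtracting this from `b`, which is `b'` plus
the signed last face, cancels that face. -/
theorem b_sub_signedT (n : ℕ) (v : F.obj (n + 1)) :
    F.b n (v - F.signedT (n + 1) v) = F.b' n v - F.signedT n (F.b' n v) := by
  have hT : F.b n (F.signedT (n + 1) v) =
      (-1 : k) ^ (n + 1) • F.face n (Fin.last (n + 1)) v + F.signedT n (F.b' n v) := by
    rw [hF.b_eq, hF.b'_eq, hF.signedFace_last, Finset.sum_range_succ', add_comm, map_sum]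
    congr 1
    · rw [← Module.End.mul_apply _ (F.signedT (n + 1)) v, ← pow_succ, Nat.sub_zero, pow_succ',
        hF.signedT_pow, mul_one, pow_zero, Module.End.one_apply]
    · refine Finset.sum_congr rfl fun i hi => ?_
      rw [← Module.End.mul_apply _ (F.signedT (n + 1)) v, ← pow_succ, pow_succ' (F.signedT n),
        Module.End.mul_apply, show n + 2 - (i + 1) + 1 = n + 2 - i by
          have := Finset.mem_range.mp hi; omega]
  rw [map_sub, hT, b_eq_b'_add]
  abel

/-- Both sides equal `N ∂₀ N`: the norm absorbs powers of `T` on either side, and the powers left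
over sum to a second norm. -/
theorem b'_norm (n : ℕ) (v : F.obj (n + 1)) :
    F.b' n (F.norm (n + 1) v) = F.norm n (F.b n v) := by
  have h1 : ∀ i, (F.signedT (n + 1) ^ i) (F.norm (n + 1) v) = F.norm (n + 1) v := by
    intro i
    induction i with
    | zero => simp
    | succ i ih => rw [pow_succ', Module.End.mul_apply, ih, hF.signedT_norm]
  have h2 : ∑ i ∈ Finset.range (n + 2), (F.signedT (n + 1) ^ (n + 2 - i)) v =
      F.norm (n + 1) v := by
    rw [← hF.signedT_norm, norm, ← Finset.sum_range_reflect, LinearMap.sum_apply, map_sum]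
    refine Finset.sum_congr rfl fun i hi => ?_
    rw [← Module.End.mul_apply, ← pow_succ']
    congr 2
    have := Finset.mem_range.mp hi
    omega
  rw [hF.b'_eq, hF.b_eq, map_sum]
  simp only [h1, hF.norm_signedT_pow]
  rw [← map_sum, ← map_sum, h2]
  generalize F.face n 0 (F.norm (n + 1) v) = u
  rw [norm, LinearMap.sum_apply]

end IsCyclic

/-- The sequence extending an element of the total complex by zero. -/
def extend {p : ℕ} (z : F.Tot p) (j : ℕ) : F.obj j :=
  if hj : j < p + 1 then z ⟨j, hj⟩ else 0

theorem extend_apply {p : ℕ} (z : F.Tot p) (j : Fin (p + 1)) : extend z j = z j := by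
  rw [extend, dif_pos j.2]

/-- The rows are read off a sequence indexed by `ℕ`, so that a recursively defined chain, or a cycle
extended by zero, can be substituted without `Fin` bookkeeping. -/
theorem D_apply_even {n : ℕ} {y : F.Tot (n + 1)} {Y : ∀ j, F.obj j}
    (hY : ∀ j : Fin (n + 2), y j = Y j) {j : ℕ} (hj : j < n + 1) (e : Even (n - j)) :
    F.D n y ⟨j, hj⟩ = F.b j (Y (j + 1)) + (Y j - F.signedT j (Y j)) := by
  have h1 := hY (Fin.succ ⟨j, hj⟩)
  have h2 := hY (Fin.castSucc ⟨j, hj⟩)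
  have h : F.D n y ⟨j, hj⟩ = F.b j (show F.obj (j + 1) from y (Fin.succ ⟨j, hj⟩)) +
      ((show F.obj j from y (Fin.castSucc ⟨j, hj⟩)) -
        F.signedT j (show F.obj j from y (Fin.castSucc ⟨j, hj⟩))) := by
    simp only [D, LinearMap.pi_apply, if_pos e]
    rfl
  rw [h, h1, h2]
  rfl

theorem D_apply_odd {n : ℕ} {y : F.Tot (n + 1)} {Y : ∀ j, F.obj j}
    (hY : ∀ j : Fin (n + 2), y j = Y j) {j : ℕ} (hj : j < n + 1) (e : ¬ Even (n - j)) :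
    F.D n y ⟨j, hj⟩ = -F.b' j (Y (j + 1)) + F.norm j (Y j) := by
  have h1 := hY (Fin.succ ⟨j, hj⟩)
  have h2 := hY (Fin.castSucc ⟨j, hj⟩)
  have h : F.D n y ⟨j, hj⟩ = -F.b' j (show F.obj (j + 1) from y (Fin.succ ⟨j, hj⟩)) +
        F.norm j (show F.obj j from y (Fin.castSucc ⟨j, hj⟩)) := by
    simp only [D, LinearMap.pi_apply, if_neg e]
    rfl
  rw [h, h1, h2]
  rfl

theorem b_zero_apply (v : F.obj 1) : F.b 0 v = F.face 0 0 v - F.face 0 1 v := by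
  simp [b, Fin.sum_univ_two, sub_eq_add_neg]

/-! ### Solving `D y = z` row by row with an extra degeneracy. -/

namespace IsContraction

variable {h : ∀ n, F.obj n →ₗ[k] F.obj (n + 1)} {e : F.obj 0 →ₗ[k] k} {χ : F.obj 0}
variable (hh : F.IsContraction h e χ)
include hh

/-- In degree zero `∂₁ h` cannot be moved past `h`; it leaves the defect `e(v) χ`, the source of the
one-dimensional homology of a `b`-column. -/
theorem b_zero (v : F.obj 0) : F.b 0 (h 0 v) = v - e v • χ := by
  have h1 := hh.face_one v
  rw [b_zero_apply, h1, hh.face_zero]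

theorem b_succ (n : ℕ) (v : F.obj (n + 1)) : F.b (n + 1) (h (n + 1) v) = v - h n (F.b n v) := by
  simp only [b, LinearMap.sum_apply, LinearMap.smul_apply, map_sum, map_smul]
  rw [Fin.sum_univ_succ]
  simp only [hh.face_zero, hh.face_succ, Fin.val_succ, Fin.val_zero, pow_zero, one_smul, pow_succ,
    mul_neg, mul_one, neg_smul, Finset.sum_neg_distrib, sub_eq_add_neg]

/-- `b'` omits the last face, hence has no defect in degree zero: the `b'`-columns are acyclic. -/
theorem b'_zero (v : F.obj 0) : F.b' 0 (h 0 v) = v := by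
  have h0 := hh.face_zero 0 v
  simp [b', h0]

theorem b'_succ (n : ℕ) (v : F.obj (n + 1)) :
    F.b' (n + 1) (h (n + 1) v) = v - h n (F.b' n v) := by
  simp only [b', LinearMap.sum_apply, LinearMap.smul_apply, map_sum, map_smul]
  rw [Fin.sum_univ_succ]
  simp only [← Fin.succ_castSucc, hh.face_succ, Fin.val_succ, Fin.val_zero, pow_zero, one_smul,
    pow_succ, mul_neg, mul_one, neg_smul, Finset.sum_neg_distrib, sub_eq_add_neg, Fin.castSucc_zero,
    hh.face_zero]

omit hh in
/-- The solution of `D y = z` with prescribed component in row zero. -/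
def solution (h : ∀ n, F.obj n →ₗ[k] F.obj (n + 1)) (p : ℕ) (z : ∀ j, F.obj j) (y₀ : F.obj 0) :
    ∀ j, F.obj j
  | 0 => y₀
  | j + 1 =>
    -- Row `j` of `D y = z` is an equation `b y_{j+1} = …` or `b' y_{j+1} = …` according to the
    -- parity of the column; applying `h` to the right-hand side solves it once that side is closed.
    if Even (p - j) then
      h j (z j - (solution h p z y₀ j - F.signedT j (solution h p z y₀ j)))
    else h j (F.norm j (solution h p z y₀ j) - z j)

theorem solution_spec (hF : F.IsCyclic) (p : ℕ) (z : ∀ j, F.obj j) (y₀ : F.obj 0)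
    (he : Even p → e (z 0 - (y₀ - F.signedT 0 y₀)) = 0)
    (hz : ∀ j, j < p → if Even (p - (j + 1)) then
      F.b j (z (j + 1)) + (z j - F.signedT j (z j)) = 0 else
      -F.b' j (z (j + 1)) + F.norm j (z j) = 0) (j : ℕ) (hj : j ≤ p) :
    if Even (p - j) then F.b j (solution h p z y₀ (j + 1)) +
      (solution h p z y₀ j - F.signedT j (solution h p z y₀ j)) = z j else
      -F.b' j (solution h p z y₀ (j + 1)) + F.norm j (solution h p z y₀ j) = z j := by
  induction j with
  | zero =>
    -- Row zero is the only place where the defect `e(·) χ` can appear, and only if its column is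
    -- even.
    by_cases ev : Even p
    · simp only [Nat.sub_zero, ev, if_true, solution]
      rw [hh.b_zero, he ev, zero_smul]
      abel
    · simp only [Nat.sub_zero, ev, if_false, solution]
      rw [hh.b'_zero]
      abel
  | succ j ih =>
    have ih := ih (by omega)
    have hz := hz j (by omega)
    have par : Even (p - j) ↔ ¬ Even (p - (j + 1)) := by
      rw [show p - j = p - (j + 1) + 1 by omega, Nat.even_add_one]
    generalize hy : solution h p z y₀ j = y at ih
    generalize hy' : solution h p z y₀ (j + 1) = y' at ih ⊢
    by_cases ev : Even (p - (j + 1))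
    -- Row `j` lies in an odd column and gives `b'y' = Ny - z_j`. Hence `b(1 - T)y' = (1 - T)b'y' =
    -- -(1 - T)z_j`, which is `b z_{j+1}` by the cycle condition.
    · rw [if_neg (by tauto)] at ih
      rw [if_pos ev] at hz
      have hb : F.b' j y' = F.norm j y - z j := by rw [← ih]; abel
      have hb' : F.b j (z (j + 1)) = -(z j - F.signedT j (z j)) := eq_neg_of_add_eq_zero_left hz
      simp only [ev, if_true]
      have hw : F.b j (z (j + 1) - (y' - F.signedT (j + 1) y')) = 0 := by
        rw [map_sub, hF.b_sub_signedT, hb, hb', map_sub, hF.signedT_norm]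
        abel
      rw [solution, if_pos ev, hy', hh.b_succ, hw, map_zero]
      abel
    -- Row `j` lies in an even column and gives `b y' = z_j - (1 - T)y`. Hence `b'Ny' = N b y' = N
    -- z_j`, which is `b' z_{j+1}` by the cycle condition.
    · rw [if_pos (by tauto)] at ih
      rw [if_neg ev] at hz
      have hb : F.b j y' = z j - (y - F.signedT j y) := by rw [← ih]; abel
      have hb' : F.b' j (z (j + 1)) = F.norm j (z j) := neg_add_eq_zero.mp hz
      simp only [ev, if_false]
      have hw : F.b' j (F.norm (j + 1) y' - z (j + 1)) = 0 := by
        rw [map_sub, hF.b'_norm, hb, hb', map_sub, map_sub, hF.norm_signedT]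
        abel
      rw [solution, if_neg ev, hy', hh.b'_succ, hw, map_zero]
      abel

/-- A cycle of the total complex bounds, with prescribed component in row zero of the bounding
chain, unless the augmentation obstructs this. -/
theorem exists_D_eq (hF : F.IsCyclic) (p : ℕ) (z : F.Tot p) (hz : z ∈ F.cycles p) (y₀ : F.obj 0)
    (he : Even p → e ((show F.obj 0 from z 0) - (y₀ - F.signedT 0 y₀)) = 0) :
    ∃ y : F.Tot (p + 1), y 0 = y₀ ∧ F.D p y = z := by
  have key := hh.solution_spec hF p (extend z) y₀ he ?_
  · refine ⟨fun j => solution h p (extend z) y₀ j, rfl, ?_⟩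
    funext j
    have hj := key j (by omega)
    rw [extend_apply] at hj
    by_cases ev : Even (p - (j : ℕ))
    · rw [if_pos ev] at hj
      rw [← hj]
      exact D_apply_even (Y := solution h p (extend z) y₀) (fun _ => rfl) j.2 ev
    · rw [if_neg ev] at hj
      rw [← hj]
      exact D_apply_odd (Y := solution h p (extend z) y₀) (fun _ => rfl) j.2 ev
  · intro j hj
    cases p with
    | zero => omega
    | succ p =>
      have hz' : F.D p z = 0 := hz
      have hz' := congrFun hz' ⟨j, hj⟩
      rw [show p + 1 - (j + 1) = p - j by omega]
      by_cases ev : Even (p - j)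
      · rw [if_pos ev]
        exact (D_apply_even (fun i => (extend_apply z i).symm) hj ev).symm.trans hz'
      · rw [if_neg ev]
        exact (D_apply_odd (fun i => (extend_apply z i).symm) hj ev).symm.trans hz'

end IsContraction

end CyclicData

/-! ### Pairings in dual cyclic theory -/

section Pairing

variable {k : Type u} [Field k]

/-- The bilinear map on cyclic homology in degree zero induced by a bilinear map that vanishes on
Hochschild boundaries. -/
def CyclicData.pairZero {F G : CyclicData k} (B : F.obj 0 →ₗ[k] G.obj 0 →ₗ[k] k)
    (hF : F.t 0 = 1) (hG : G.t 0 = 1)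
    (hB₁ : ∀ v y, B (F.b 0 v) y = 0) (hB₂ : ∀ x w, B x (G.b 0 w) = 0) :
    F.HC 0 →ₗ[k] G.HC 0 →ₗ[k] k :=
  -- With `t₀ = 1` the horizontal map `1 - T` vanishes in row zero, so boundaries of total degree
  -- zero are Hochschild boundaries.
  have key : ∀ (E : CyclicData k) (hE : E.t 0 = 1) (x : E.cycles 0), x ∈ E.boundaries 0 →
      ∃ v : E.obj 1, x.1 0 = E.b 0 v := fun E hE x ⟨y, hy⟩ => by
    refine ⟨y 1, ?_⟩
    have hy' : E.D 0 y = x.1 := hy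
    rw [← hy']
    have h := CyclicData.D_apply_even (F := E) (n := 0) (y := y) (Y := CyclicData.extend y)
      (fun j => (CyclicData.extend_apply y j).symm) (j := 0) (by simp) (by simp)
    refine h.trans ?_
    simp only [CyclicData.signedT, hE, pow_zero, one_smul, Module.End.one_apply, sub_self, add_zero]
    rfl
  let P := fun E : CyclicData k => LinearMap.proj (R := k) (φ := fun j : Fin 1 => E.obj j) 0 ∘ₗ
    (E.cycles 0).subtype
  (F.boundaries 0).liftQ
    (((G.boundaries 0).liftQ ((B.compl₁₂ (P F) (P G)).flip) (by
      intro y hy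
      obtain ⟨w, hw⟩ := key G hG y hy
      refine LinearMap.mem_ker.mpr (LinearMap.ext fun x => ?_)
      refine Eq.trans ?_ (hB₂ (x.1 0) w)
      rw [← hw]
      rfl)).flip) (by
    intro x hx
    obtain ⟨v, hv⟩ := key F hF x hx
    refine LinearMap.mem_ker.mpr (LinearMap.ext fun y => ?_)
    obtain ⟨y, rfl⟩ := (G.boundaries 0).mkQ_surjective y
    refine Eq.trans ?_ (hB₁ v (y.1 0))
    rw [← hv]
    rfl)

/-- The extension of a pairing in degree zero to all degrees along the periodicity operators. -/
def CyclicData.pair {F G : CyclicData k} (B : F.HC 0 →ₗ[k] G.HC 0 →ₗ[k] k) :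
    ∀ p, F.HC p →ₗ[k] G.HC p →ₗ[k] k
  | 0 => B
  -- Odd degrees are zero because `κ` is zero there.
  | 1 => 0
  | p + 2 => (CyclicData.pair B p).compl₁₂ (F.S p) (G.S p)

theorem CyclicData.pair_odd {F G : CyclicData k} (B : F.HC 0 →ₗ[k] G.HC 0 →ₗ[k] k) (p : ℕ)
    (hp : Odd p) : CyclicData.pair B p = 0 := by
  induction p using Nat.twoStepInduction with
  | zero => simp at hp
  | one => rfl
  | more p ih _ =>
    have : Odd p := by simpa [Nat.odd_add, parity_simps] using hp
    rw [CyclicData.pair, ih this]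
    rfl

/-- `κ` converts the two conditions on `μ` into a recursion for `β` with step two, starting from `κ₀
J₀` and `0`; its bijectivity in even degrees converts a solution of the recursion back into an
induced product. Only `J` in degree zero enters. -/
theorem existsUnique_pairing (X Y Z : CocyclicData k)
    (J : ∀ n : ℕ, X.obj n →ₗ[k] Y.obj n →ₗ[k] Z.obj n)
    (κ : ∀ p, DualHC Z p →ₗ[k] k) (e : Z.obj 0 →ₗ[k] k)
    (κ_zero : ∀ z, κ 0 (Z.dual.cls 0 z) = e (z.1 0))
    (κ_S : ∀ p z, κ p (Z.dual.S p z) = κ (p + 2) z)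
    (κ_even : ∀ p, Even p → Function.Bijective (κ p)) (κ_odd : ∀ p, Odd p → κ p = 0)
    (hX : ∀ v y, e (J 0 (X.dual.b 0 v) y) = 0) (hY : ∀ x w, e (J 0 x (Y.dual.b 0 w)) = 0) :
    ∃! β : ∀ p : ℕ, DualHC X p →ₗ[k] DualHC Y p →ₗ[k] k,
      ∃ μ : ∀ p : ℕ, DualHC X p →ₗ[k] DualHC Y p →ₗ[k] DualHC Z p,
        IsInducedProduct X Y Z J μ ∧ ∀ p ξ η, β p ξ η = κ p (μ p ξ η) := by
  let B : DualHC X 0 →ₗ[k] DualHC Y 0 →ₗ[k] k :=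
    CyclicData.pairZero (F := X.dual) (G := Y.dual) ((J 0).compr₂ e) rfl rfl hX hY
  let β : ∀ p : ℕ, DualHC X p →ₗ[k] DualHC Y p →ₗ[k] k := CyclicData.pair B
  let μ : ∀ p : ℕ, DualHC X p →ₗ[k] DualHC Y p →ₗ[k] DualHC Z p := fun p =>
    -- In even degrees `κ_p μ_p = β_p` leaves no choice for `μ_p`.
    if hp : Even p then
      (β p).compr₂ (LinearEquiv.ofBijective (κ p) (κ_even p hp)).symm.toLinearMap
    else 0
  have hμ : ∀ p ξ η, β p ξ η = κ p (μ p ξ η) := by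
    intro p ξ η
    by_cases hp : Even p
    · simp only [μ, dif_pos hp, LinearMap.compr₂_apply]
      exact ((LinearEquiv.ofBijective (κ p) (κ_even p hp)).apply_symm_apply _).symm
    · rw [κ_odd p (Nat.not_even_iff_odd.mp hp)]
      simp only [β, CyclicData.pair_odd B p (Nat.not_even_iff_odd.mp hp)]
      rfl
  refine ⟨β, ⟨μ, ⟨?_, ?_⟩, hμ⟩, ?_⟩
  -- Injectivity of `κ₀` reduces the equality of classes to the equality of their values under `e`.
  · intro x y z hz
    apply (κ_even 0 Even.zero).injective
    rw [← hμ, κ_zero, hz]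
    rfl
  · intro p ξ η
    by_cases hp : Even p
    · apply (κ_even p hp).injective
      rw [κ_S, ← hμ, ← hμ]
      rfl
    · have hp' : ¬ Even (p + 2) := by simpa [parity_simps] using hp
      simp only [μ, dif_neg hp, dif_neg hp', LinearMap.zero_apply, map_zero]
  -- Uniqueness: `β'_{p+2} = κ_{p+2} μ'_{p+2} = κ_p S μ'_{p+2} = κ_p μ'_p(S, S) = β'_p(S, S)`.
  · rintro β' ⟨μ', ⟨h0, hS⟩, hβ⟩
    funext p
    induction p using Nat.twoStepInduction with
    | zero =>
      refine LinearMap.ext fun ξ => LinearMap.ext fun η => ?_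
      obtain ⟨x, rfl⟩ := (X.dual.boundaries 0).mkQ_surjective ξ
      obtain ⟨y, rfl⟩ := (Y.dual.boundaries 0).mkQ_surjective η
      have hz := h0 x y ⟨fun j => match j with | 0 => J 0 (x.1 0) (y.1 0), Submodule.mem_top⟩ rfl
      rw [hβ]
      refine (congrArg (κ 0) hz).trans ((κ_zero _).trans rfl)
    | one =>
      refine LinearMap.ext fun ξ => LinearMap.ext fun η => ?_
      rw [hβ, κ_odd 1 odd_one]
      rfl
    | more p ih _ =>
      refine LinearMap.ext fun ξ => LinearMap.ext fun η => ?_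
      rw [hβ, ← κ_S, hS, ← hβ, ih]
      rfl

end Pairing

/-! ### Pure tensors and rotations -/

section Rotation

variable {k : Type u} [Field k] {V : Type u} [AddCommGroup V] [Module k V]

theorem TPow.hom_ext_cons {n : ℕ} {N : Type*} [AddCommGroup N] [Module k N]
    {f g : TPow k V (n + 1) →ₗ[k] N}
    (h : ∀ a w, f (TPow.cons n (a ⊗ₜ[k] w)) = g (TPow.cons n (a ⊗ₜ[k] w))) : f = g := by
  refine LinearMap.ext fun w => ?_
  obtain ⟨z, rfl⟩ := (TPow.cons n).surjective w
  have : f ∘ₗ (TPow.cons n).toLinearMap = g ∘ₗ (TPow.cons n).toLinearMap := TensorProduct.ext' h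
  exact LinearMap.congr_fun this z

theorem TPow.nil_eq_smul (w : TPow k V 0) : ∃ c : k, w = c • TPow.nil (1 : k) := by
  obtain ⟨c, rfl⟩ := TPow.nil.surjective w
  exact ⟨c, by rw [← map_smul, smul_eq_mul, mul_one]⟩

theorem TPow.hom_ext_nil {N : Type*} [AddCommGroup N] [Module k N] {f g : TPow k V 0 →ₗ[k] N}
    (h : f (TPow.nil 1) = g (TPow.nil 1)) : f = g := by
  refine LinearMap.ext fun w => ?_
  obtain ⟨c, rfl⟩ := TPow.nil_eq_smul w
  rw [map_smul, map_smul, h]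

/-- The pure tensor `v₀ ⊗ ⋯ ⊗ vₙ₋₁`. -/
def TPow.tprod : (n : ℕ) → (Fin n → V) → TPow k V n
  | 0, _ => TPow.nil 1
  | n + 1, v => TPow.cons n (v 0 ⊗ₜ[k] TPow.tprod n (fun i => v i.succ))

theorem TPow.hom_ext_tprod {n : ℕ} {N : Type*} [AddCommGroup N] [Module k N]
    {f g : TPow k V n →ₗ[k] N} (h : ∀ v, f (TPow.tprod n v) = g (TPow.tprod n v)) : f = g := by
  induction n with
  | zero => exact TPow.hom_ext_nil (h 0)
  | succ n ih =>
    refine TPow.hom_ext_cons fun a w => ?_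
    have := @ih (f ∘ₗ (TPow.cons n).toLinearMap ∘ₗ TensorProduct.mk k V _ a)
      (g ∘ₗ (TPow.cons n).toLinearMap ∘ₗ TensorProduct.mk k V _ a) fun v => by
        simpa [TPow.tprod] using h (Fin.cons a v)
    exact LinearMap.congr_fun this w

theorem lastFirst_tprod (n : ℕ) (v : Fin (n + 1) → V) :
    lastFirst n (v 0 ⊗ₜ[k] TPow.tprod n (fun i => v i.succ)) =
      v (Fin.last n) ⊗ₜ[k] TPow.tprod n (fun i => v i.castSucc) := by
  induction n with
  | zero => rfl
  | succ n ih =>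
    rw [TPow.tprod, lastFirst_succ, ih (fun i => v i.succ), TensorProduct.leftComm_tmul,
      LinearMap.lTensor_tmul]
    rfl

theorem lastFirst_firstLast (n : ℕ) (z : V ⊗[k] TPow k V n) : lastFirst n (firstLast n z) = z := by
  induction n with
  | zero => rfl
  | succ n ih =>
    suffices lastFirst (n + 1) ∘ₗ firstLast (n + 1) =
        (LinearMap.id : V ⊗[k] TPow k V (n + 1) →ₗ[k] _) from LinearMap.congr_fun this z
    refine TensorProduct.ext (LinearMap.ext fun a => TPow.hom_ext_cons fun b w => ?_)
    simp [firstLast_succ, lastFirst_succ, ih]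

variable (k V) in
/-- `v₀ ⊗ v₁ ⊗ ⋯ ⊗ vₙ ↦ vₙ ⊗ v₀ ⊗ ⋯ ⊗ vₙ₋₁`, as an endomorphism of `V^{⊗ (n+1)}`. -/
def rotate (n : ℕ) : Module.End k (TPow k V (n + 1)) :=
  (TPow.cons n).toLinearMap ∘ₗ lastFirst n ∘ₗ (TPow.cons n).symm.toLinearMap

theorem rotate_cons (n : ℕ) (z : V ⊗[k] TPow k V n) :
    rotate k V n (TPow.cons n z) = TPow.cons n (lastFirst n z) := by
  simp [rotate]

/-- Subtraction in `Fin (n + 1)` wraps around, `0 - 1` being the last index, so the rotation is a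
translation of `ℤ/(n+1)`. -/
theorem rotate_tprod (n : ℕ) (v : Fin (n + 1) → V) :
    rotate k V n (TPow.tprod (n + 1) v) = TPow.tprod (n + 1) (fun i => v (i - 1)) := by
  have h (i : Fin n) : (i.succ - 1 : Fin (n + 1)) = i.castSucc := by
    rw [sub_eq_iff_eq_add, Fin.coeSucc_eq_succ]
  have h0 : (0 - 1 : Fin (n + 1)) = Fin.last n := by
    rw [sub_eq_iff_eq_add, Fin.last_add_one]
  rw [TPow.tprod, rotate_cons, lastFirst_tprod, TPow.tprod]
  simp only [h, h0]

theorem rotate_pow (n : ℕ) : rotate k V n ^ (n + 1) = 1 := by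
  refine TPow.hom_ext_tprod fun v => ?_
  have h : ∀ j : ℕ, (rotate k V n ^ j) (TPow.tprod (n + 1) v) =
      TPow.tprod (n + 1) (fun i => v (i - j • 1)) := by
    intro j
    induction j with
    | zero => simp
    | succ j ih =>
      rw [pow_succ', Module.End.mul_apply, ih, rotate_tprod]
      simp only [succ_nsmul', sub_sub]
  have h1 : (n + 1) • (1 : Fin (n + 1)) = 0 := by
    simpa using card_nsmul_eq_zero (x := (1 : Fin (n + 1)))
  rw [h, h1]
  simp

/-- The `n`-th power is the inverse rotation. This makes the cyclic operator of the dual, defined as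
`t ^ n`, computable. -/
theorem rotate_pow_cons (n : ℕ) (z : V ⊗[k] TPow k V n) :
    (rotate k V n ^ n) (TPow.cons n z) = TPow.cons n (firstLast n z) := by
  have h : TPow.cons n z = rotate k V n (TPow.cons n (firstLast n z)) := by
    rw [rotate_cons, lastFirst_firstLast]
  rw [h, ← Module.End.mul_apply, ← pow_succ, rotate_pow, Module.End.one_apply]

theorem underCons_cons {n m : ℕ} (f : TPow k V n →ₗ[k] TPow k V m) (a : V) (w : TPow k V n) :
    underCons f (TPow.cons n (a ⊗ₜ[k] w)) = TPow.cons m (a ⊗ₜ[k] f w) := by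
  simp [underCons]

end Rotation

/-! ### The dual cyclic theory of an algebra is that of a point -/

section Point

variable {k : Type u} [Field k] {A : Type u} [Ring A] [Algebra k A]

theorem unitAt_zero (n : ℕ) (w : TPow k A n) :
    unitAt n 0 w = TPow.cons n ((1 : A) ⊗ₜ[k] w) := by
  cases n <;> rfl

theorem unitAt_succ_cons (n : ℕ) (i : Fin (n + 1)) (a : A) (w : TPow k A n) :
    unitAt (n + 1) i.succ (TPow.cons n (a ⊗ₜ[k] w)) =
      TPow.cons (n + 1) (a ⊗ₜ[k] unitAt n i w) :=
  underCons_cons _ _ _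

/-- Once `a` leaves the front, a unit inserted behind it drops by one index. Transposed, this is the
relation between consecutive faces and `t` in the cyclic dual. -/
theorem firstLast_unitAt (n : ℕ) (i : Fin (n + 1)) (a : A) (w : TPow k A n) :
    TPow.cons (n + 1) (firstLast (n + 1) (a ⊗ₜ[k] unitAt n i w)) =
      unitAt (n + 1) i.castSucc (TPow.cons n (firstLast n (a ⊗ₜ[k] w))) := by
  induction n with
  | zero =>
    obtain rfl : i = 0 := Fin.fin_one_eq_zero i
    rw [Fin.castSucc_zero, unitAt_zero, unitAt_zero, firstLast_succ]
  | succ n ih =>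
    refine Fin.cases ?_ (fun i => ?_) i
    · rw [Fin.castSucc_zero, unitAt_zero, unitAt_zero, firstLast_succ]
    · suffices h : (TPow.cons (n + 2)).toLinearMap ∘ₗ firstLast (n + 2) ∘ₗ
          TensorProduct.mk k A _ a ∘ₗ unitAt (n + 1) i.succ =
          unitAt (n + 2) i.succ.castSucc ∘ₗ (TPow.cons (n + 1)).toLinearMap ∘ₗ
            firstLast (n + 1) ∘ₗ TensorProduct.mk k A _ a from LinearMap.congr_fun h w
      refine TPow.hom_ext_cons fun b w => ?_
      simp only [LinearMap.comp_apply, LinearEquiv.coe_coe, TensorProduct.mk_apply]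
      rw [unitAt_succ_cons, firstLast_succ, firstLast_succ, ih, ← Fin.succ_castSucc,
        unitAt_succ_cons]

/-- `a₀ ⊗ ⋯ ⊗ aₙ ↦ χ(a₀) a₁ ⊗ ⋯ ⊗ aₙ`. -/
def evalHead (χ : A →ₗ[k] k) (n : ℕ) : TPow k A (n + 1) →ₗ[k] TPow k A n :=
  (TensorProduct.lid k (TPow k A n)).toLinearMap ∘ₗ χ.rTensor (TPow k A n) ∘ₗ
    (TPow.cons n).symm.toLinearMap

theorem evalHead_cons (χ : A →ₗ[k] k) (n : ℕ) (a : A) (w : TPow k A n) :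
    evalHead χ n (TPow.cons n (a ⊗ₜ[k] w)) = χ a • w := by
  simp [evalHead]

theorem ordinaryCocyclic_t_pow (n i : ℕ) (φ : Module.Dual k (TPow k A (n + 1)))
    (w : TPow k A (n + 1)) :
    (show Module.Dual k (TPow k A (n + 1)) from ((ordinaryCocyclic k A).t n ^ i) φ) w =
      φ ((rotate k A n ^ i) w) := by
  induction i generalizing φ w with
  | zero => rfl
  | succ i ih =>
    have h : ((ordinaryCocyclic k A).t n ^ (i + 1)) φ =
        ((ordinaryCocyclic k A).t n ^ i) ((ordinaryCocyclic k A).t n φ) :=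
      LinearMap.congr_fun (pow_succ ((ordinaryCocyclic k A).t n) i) φ
    refine (congrArg (fun f => (show Module.Dual k (TPow k A (n + 1)) from f) w) h).trans
      ((ih _ w).trans ?_)
    rw [pow_succ', Module.End.mul_apply]
    rfl

theorem dual_t_apply (n : ℕ) (φ : Module.Dual k (TPow k A (n + 1))) (z : A ⊗[k] TPow k A n) :
    (show Module.Dual k (TPow k A (n + 1)) from (ordinaryCocyclic k A).dual.t n φ)
      (TPow.cons n z) = φ (TPow.cons n (firstLast n z)) :=
  (ordinaryCocyclic_t_pow n n φ _).trans (congrArg φ (rotate_pow_cons n z))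

theorem CocyclicData.dual_face_castSucc (X : CocyclicData k) (n : ℕ) (i : Fin (n + 1)) :
    X.dual.face n i.castSucc = X.s n i := by
  simp [CocyclicData.dual]
  rfl

theorem CocyclicData.dual_face_last (X : CocyclicData k) (n : ℕ) :
    X.dual.face n (Fin.last (n + 1)) = X.s n 0 ∘ₗ X.t (n + 1) ^ (n + 1) := by
  simp [CocyclicData.dual]
  rfl

theorem CocyclicData.dual_t (X : CocyclicData k) (n : ℕ) : X.dual.t n = X.t n ^ n := rfl

theorem CocyclicData.dual_t_pow (X : CocyclicData k) (n : ℕ) (h : X.t n ^ (n + 1) = 1) :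
    X.dual.t n ^ (n + 1) = 1 :=
  show (X.t n ^ n) ^ (n + 1) = 1 by rw [← pow_mul, mul_comm, pow_mul, h, one_pow]

theorem dual_face_castSucc_apply (n : ℕ) (i : Fin (n + 1))
    (φ : Module.Dual k (TPow k A (n + 2))) (w : TPow k A (n + 1)) :
    (show Module.Dual k (TPow k A (n + 1)) from
      (ordinaryCocyclic k A).dual.face n i.castSucc φ) w = φ (unitAt (n + 1) i.succ w) := by
  rw [CocyclicData.dual_face_castSucc]
  rfl

/-- The unit enters right after `a₀`; the inverse rotation then carries `a₀` to the end and leaves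
the unit in front. -/
theorem dual_face_last_apply (n : ℕ) (φ : Module.Dual k (TPow k A (n + 2))) (a : A)
    (w : TPow k A n) :
    (show Module.Dual k (TPow k A (n + 1)) from
      (ordinaryCocyclic k A).dual.face n (Fin.last (n + 1)) φ) (TPow.cons n (a ⊗ₜ[k] w)) =
      φ (TPow.cons (n + 1) ((1 : A) ⊗ₜ[k] TPow.cons n (firstLast n (a ⊗ₜ[k] w)))) := by
  rw [CocyclicData.dual_face_last]
  refine (ordinaryCocyclic_t_pow (n + 1) (n + 1) φ (unitAt (n + 1) 1 _)).trans ?_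
  have h : unitAt (n + 1) 1 (TPow.cons n (a ⊗ₜ[k] w)) =
      TPow.cons (n + 1) (a ⊗ₜ[k] unitAt n 0 w) := unitAt_succ_cons n 0 a w
  rw [h, rotate_pow_cons, unitAt_zero, firstLast_succ]

theorem ordinaryCocyclic_dual_isCyclic : (ordinaryCocyclic k A).dual.IsCyclic where
  t_pow n := by
    refine CocyclicData.dual_t_pow _ n (LinearMap.ext fun φ => LinearMap.ext fun w => ?_)
    refine (ordinaryCocyclic_t_pow n (n + 1) φ w).trans ?_
    rw [rotate_pow]
    rfl
  face_last n :=
    (CocyclicData.dual_face_last _ n).trans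
      (congrArg (· ∘ₗ (ordinaryCocyclic k A).t (n + 1) ^ (n + 1))
        (CocyclicData.dual_face_castSucc _ n 0).symm)
  face_succ n j := by
    refine LinearMap.ext fun φ => TPow.hom_ext_cons fun a w => ?_
    refine (dual_face_castSucc_apply n j.succ _ _).trans ?_
    refine Eq.trans ?_ (dual_t_apply n _ _).symm
    refine Eq.trans ?_ (dual_face_castSucc_apply n j.castSucc φ _).symm
    rw [unitAt_succ_cons]
    refine (dual_t_apply (n + 1) φ _).trans ?_
    rw [firstLast_unitAt, Fin.succ_castSucc]

/-- The zeroth face inserts a unit after `a₀`, so `χ` is evaluated on the slot after `a₀` and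
removes that unit. -/
theorem ordinaryCocyclic_dual_isContraction (χ : A →ₗ[k] k) (hχ : χ 1 = 1) :
    (ordinaryCocyclic k A).dual.IsContraction (fun n => (underCons (evalHead χ n)).dualMap)
      (evalOne A) (TPow.nil.symm.toLinearMap ∘ₗ evalHead χ 0) where
  face_zero n := fun (φ : Module.Dual k (TPow k A (n + 1))) => by
    refine TPow.hom_ext_cons fun a w => ?_
    refine (dual_face_castSucc_apply n 0 _ _).trans ?_
    change φ (underCons (evalHead χ n) _) = _
    rw [unitAt_succ_cons, unitAt_zero, underCons_cons, evalHead_cons, hχ, one_smul]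
  face_succ n i := fun (φ : Module.Dual k (TPow k A (n + 2))) => by
    refine TPow.hom_ext_cons fun a w => ?_
    refine Fin.lastCases ?_ (fun i => ?_) i
    -- On `a ⊗ b ⊗ w` both sides are `χ(b) φ(1, w, a)`; a slot `b` other than `a` is needed, which
    -- is why degree zero is exceptional.
    · rw [Fin.succ_last]
      refine (dual_face_last_apply (n + 1) _ _ _).trans ?_
      change φ (underCons (evalHead χ (n + 1)) _) =
        (show Module.Dual k (TPow k A (n + 1)) from (ordinaryCocyclic k A).dual.face n _ φ)
          (underCons (evalHead χ n) _)
      rw [underCons_cons, underCons_cons]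
      suffices h : TensorProduct.mk k A _ 1 ∘ₗ evalHead χ (n + 1) ∘ₗ
          (TPow.cons (n + 1)).toLinearMap ∘ₗ
          firstLast (n + 1) ∘ₗ TensorProduct.mk k A _ a = TensorProduct.mk k A _ 1 ∘ₗ
          (TPow.cons n).toLinearMap ∘ₗ firstLast n ∘ₗ TensorProduct.mk k A _ a ∘ₗ evalHead χ n from
        (congrArg (fun z => φ (TPow.cons (n + 1) z)) (LinearMap.congr_fun h w)).trans
          (dual_face_last_apply n φ a _).symm
      refine TPow.hom_ext_cons fun b w => ?_
      simp [firstLast_succ, evalHead_cons]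
    · rw [Fin.succ_castSucc]
      refine (dual_face_castSucc_apply (n + 1) i.succ _ _).trans ?_
      change φ (underCons (evalHead χ (n + 1)) _) =
        (show Module.Dual k (TPow k A (n + 1)) from (ordinaryCocyclic k A).dual.face n _ φ)
          (underCons (evalHead χ n) _)
      rw [unitAt_succ_cons, underCons_cons, underCons_cons]
      refine Eq.trans ?_ (dual_face_castSucc_apply n i φ _).symm
      rw [unitAt_succ_cons]
      suffices h : evalHead χ (n + 1) ∘ₗ unitAt (n + 1) i.succ = unitAt n i ∘ₗ evalHead χ n from
        congrArg (fun z => φ (TPow.cons (n + 1) (a ⊗ₜ[k] z))) (LinearMap.congr_fun h w)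
      refine TPow.hom_ext_cons fun b w => ?_
      simp [unitAt_succ_cons, evalHead_cons]
  face_one := fun (φ : Module.Dual k (TPow k A 1)) => by
    refine TPow.hom_ext_cons fun a w => ?_
    obtain ⟨c, rfl⟩ := TPow.nil_eq_smul w
    -- Here `χ` meets `a₀` itself and the inserted unit goes into `φ`, giving `φ(1) χ(a₀)`.
    refine (dual_face_last_apply 0 _ _ _).trans ?_
    change φ (underCons (evalHead χ 0) _) = φ _ * TPow.nil.symm (evalHead χ 0 _)
    rw [underCons_cons, firstLast, LinearMap.id_apply, evalHead_cons]
    simp only [TensorProduct.tmul_smul, map_smul, LinearEquiv.symm_apply_apply, smul_eq_mul,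
      mul_one, smul_smul]
    exact mul_comm _ _

-- This is where `A ≠ 0` enters.
variable (k A) in
theorem exists_linearFunctional_one [Nontrivial A] : ∃ χ : A →ₗ[k] k, χ 1 = 1 := by
  exact Module.Projective.exists_dual_eq_one k one_ne_zero

theorem pointFunctional_cls_even {p : ℕ} (hp : Even p)
    (z : (ordinaryCocyclic k A).dual.cycles p) :
    pointFunctional A p ((ordinaryCocyclic k A).dual.cls p z) = evalOne A (z.1 0) := by
  change (if Even p then _ else _ : _ →ₗ[k] k) z = _
  rw [if_pos hp]
  rfl

theorem pointFunctional_odd {p : ℕ} (hp : Odd p) : pointFunctional (k := k) A p = 0 := by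
  refine LinearMap.ext fun ζ => ?_
  obtain ⟨z, rfl⟩ := ((ordinaryCocyclic k A).dual.boundaries p).mkQ_surjective ζ
  change (if Even p then _ else _ : _ →ₗ[k] k) z = _
  rw [if_neg (Nat.not_even_iff_odd.mpr hp)]
  rfl

/-- Forgetting the first two columns does not touch the row-zero component. -/
theorem pointFunctional_S (p : ℕ) (ζ : DualHC (ordinaryCocyclic k A) (p + 2)) :
    pointFunctional A p ((ordinaryCocyclic k A).dual.S p ζ) = pointFunctional A (p + 2) ζ := by
  obtain ⟨z, rfl⟩ := ((ordinaryCocyclic k A).dual.boundaries (p + 2)).mkQ_surjective ζ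
  rcases Nat.even_or_odd p with hp | hp
  · have hp' : Even (p + 2) := by simpa [parity_simps] using hp
    exact (pointFunctional_cls_even hp ⟨_, CyclicData.shift_mem_cycles _ p z.1 z.2⟩).trans
      (pointFunctional_cls_even hp' z).symm
  · have hp' : Odd (p + 2) := by simpa [Nat.odd_add, parity_simps] using hp
    rw [pointFunctional_odd hp, pointFunctional_odd hp']
    rfl

theorem exists_D_eq_of_evalOne [Nontrivial A] (p : ℕ) (z : (ordinaryCocyclic k A).dual.Tot p)
    (hz : z ∈ (ordinaryCocyclic k A).dual.cycles p) (y₀ : (ordinaryCocyclic k A).dual.obj 0)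
    (he : Even p → evalOne A (z 0) = 0) :
    ∃ y : (ordinaryCocyclic k A).dual.Tot (p + 1), y 0 = y₀ ∧
      (ordinaryCocyclic k A).dual.D p y = z := by
  obtain ⟨χ, hχ⟩ := exists_linearFunctional_one k A
  refine (ordinaryCocyclic_dual_isContraction χ hχ).exists_D_eq ordinaryCocyclic_dual_isCyclic p z
    hz y₀ fun hp => ?_
  -- As `1 - T` vanishes in row zero, the obstruction does not depend on the chosen `y₀`.
  have ht : (ordinaryCocyclic k A).dual.signedT 0 = LinearMap.id := by
    simp [CyclicData.signedT, CocyclicData.dual_t, Module.End.one_eq_id]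
    exact one_smul _ _
  rw [ht, LinearMap.id_apply, sub_self, sub_zero]
  exact he hp

theorem boundaries_of_pointFunctional [Nontrivial A] (p : ℕ)
    (ζ : DualHC (ordinaryCocyclic k A) p) (h : pointFunctional A p ζ = 0) : ζ = 0 := by
  obtain ⟨z, rfl⟩ := ((ordinaryCocyclic k A).dual.boundaries p).mkQ_surjective ζ
  obtain ⟨y, -, hy⟩ := exists_D_eq_of_evalOne p z.1 z.2 0 fun hp =>
    (pointFunctional_cls_even hp z).symm.trans h
  exact (Submodule.Quotient.mk_eq_zero _).mpr ⟨y, hy⟩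

theorem pointFunctional_bijective [Nontrivial A] (p : ℕ) (hp : Even p) :
    Function.Bijective (pointFunctional (k := k) A p) := by
  refine ⟨(injective_iff_map_eq_zero _).mpr (boundaries_of_pointFunctional p), ?_⟩
  rw [← LinearMap.range_eq_top]
  obtain ⟨χ, hχ⟩ := exists_linearFunctional_one k A
  suffices h : ∃ z ∈ (ordinaryCocyclic k A).dual.cycles p, evalOne A (z 0) = 1 by
    obtain ⟨z, hz, hz1⟩ := h
    refine LinearMap.range_eq_top.mpr fun c => ⟨c • (ordinaryCocyclic k A).dual.cls p ⟨z, hz⟩, ?_⟩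
    rw [map_smul, pointFunctional_cls_even hp, hz1, smul_eq_mul, mul_one]
  let χ₀ : (ordinaryCocyclic k A).dual.obj 0 := TPow.nil.symm.toLinearMap ∘ₗ evalHead χ 0
  have h1 : evalOne A χ₀ = 1 := by
    change TPow.nil.symm (evalHead χ 0 (TPow.cons 0 ((1 : A) ⊗ₜ[k] TPow.nil (1 : k)))) = 1
    rw [evalHead_cons, hχ, one_smul, LinearEquiv.symm_apply_apply]
  cases p with
  | zero => exact ⟨fun j => match j with | 0 => χ₀, Submodule.mem_top, h1⟩
  | succ q =>
    -- Solving `D y = 0` with `y₀ = χ` extends `χ` to a cycle with value `χ(1) = 1`.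
    obtain ⟨y, hy, hD⟩ := exists_D_eq_of_evalOne (A := A) (k := k) q 0 (Submodule.zero_mem _) χ₀
      fun _ => map_zero _
    exact ⟨y, hD, (congrArg (evalOne A) hy).trans h1⟩

theorem dualHC_subsingleton [Nontrivial A] (p : ℕ) (hp : Odd p) :
    Subsingleton (DualHC (ordinaryCocyclic k A) p) :=
  subsingleton_of_forall_eq 0 fun ζ =>
    boundaries_of_pointFunctional p ζ (by rw [pointFunctional_odd hp]; rfl)

end Point

/-! ### The Janus map is a morphism of cocyclic modules -/

section Action

variable {k H : Type u} [Field k] [Ring H] [HopfAlgebra k H]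
variable {C A : Type u} [AddCommGroup C] [Module k C] [Coalgebra k C] [Module H C]
  [IsScalarTower k H C] [Ring A] [Algebra k A] [Module H A] [IsScalarTower k H A]

theorem actAt_cons (ρ : C →ₗ[k] A →ₗ[k] A) (n : ℕ) (y : C ⊗[k] TPow k C n)
    (z : A ⊗[k] TPow k A n) :
    actAt ρ (n + 1) (TPow.cons n y) (TPow.cons n z) =
      TPow.cons n (TensorProduct.map₂ ρ (actAt ρ n) y z) := by
  simp [actAt, LinearEquiv.conj_apply]

theorem actAt_cons_tmul (ρ : C →ₗ[k] A →ₗ[k] A) (n : ℕ) (c : C) (w : TPow k C n) (a : A)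
    (u : TPow k A n) :
    actAt ρ (n + 1) (TPow.cons n (c ⊗ₜ[k] w)) (TPow.cons n (a ⊗ₜ[k] u)) =
      TPow.cons n (ρ c a ⊗ₜ[k] actAt ρ n w u) := by
  simp [actAt_cons]

/-- Bilinear maps on tensor powers of positive degree agree if they agree on decomposed tensors. -/
theorem TPow.hom_ext_cons₂ {n m : ℕ} {N : Type*} [AddCommGroup N] [Module k N]
    {f g : TPow k C (n + 1) →ₗ[k] TPow k A (m + 1) →ₗ[k] N}
    (h : ∀ c w a u, f (TPow.cons n (c ⊗ₜ[k] w)) (TPow.cons m (a ⊗ₜ[k] u)) =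
      g (TPow.cons n (c ⊗ₜ[k] w)) (TPow.cons m (a ⊗ₜ[k] u))) : f = g :=
  TPow.hom_ext_cons fun c w => TPow.hom_ext_cons fun a u => h c w a u

theorem comulAt_zero_cons (n : ℕ) (c : C) (w : TPow k C n) :
    comulAt (n + 1) 0 (TPow.cons n (c ⊗ₜ[k] w)) =
      TPow.cons (n + 1) ((TPow.cons n).toLinearMap.lTensor C
        (TensorProduct.assoc k C C (TPow k C n) (comul c ⊗ₜ[k] w))) := by
  simp [comulAt]

theorem comulAt_succ_cons (n : ℕ) (i : Fin n) (c : C) (w : TPow k C n) :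
    comulAt (n + 1) i.succ (TPow.cons n (c ⊗ₜ[k] w)) =
      TPow.cons (n + 1) (c ⊗ₜ[k] comulAt n i w) :=
  underCons_cons _ _ _

theorem counitAt_zero_cons (n : ℕ) (c : C) (w : TPow k C n) :
    counitAt n 0 (TPow.cons n (c ⊗ₜ[k] w)) = (counit c : k) • w := by
  cases n <;> simp [counitAt]

theorem counitAt_succ_cons (n : ℕ) (i : Fin (n + 1)) (c : C) (w : TPow k C (n + 1)) :
    counitAt (n + 1) i.succ (TPow.cons (n + 1) (c ⊗ₜ[k] w)) =
      TPow.cons n (c ⊗ₜ[k] counitAt n i w) :=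
  underCons_cons _ _ _

theorem mulAt_zero_cons (n : ℕ) (a b : A) (u : TPow k A n) :
    mulAt (n + 1) 0 (TPow.cons (n + 1) (a ⊗ₜ[k] TPow.cons n (b ⊗ₜ[k] u))) =
      TPow.cons n ((a * b) ⊗ₜ[k] u) := by
  simp [mulAt]

theorem mulAt_succ_cons (n : ℕ) (i : Fin n) (a : A) (u : TPow k A (n + 1)) :
    mulAt (n + 1) i.succ (TPow.cons (n + 1) (a ⊗ₜ[k] u)) = TPow.cons n (a ⊗ₜ[k] mulAt n i u) :=
  underCons_cons _ _ _

theorem mulAt_actAt_comulAt (ρ : EquivariantAction k H C A) (n : ℕ) (i : Fin n) (w : TPow k C n)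
    (u : TPow k A (n + 1)) :
    mulAt n i (actAt ρ.act (n + 1) (comulAt n i w) u) = actAt ρ.act n w (mulAt n i u) := by
  induction n with
  | zero => exact i.elim0
  | succ n ih =>
    suffices h : ((actAt ρ.act (n + 2) ∘ₗ comulAt (n + 1) i).compr₂ (mulAt (n + 1) i)) =
        (actAt ρ.act (n + 1)).compl₂ (mulAt (n + 1) i) from
      LinearMap.congr_fun₂ h w u
    refine TPow.hom_ext_cons₂ fun c w a u => ?_
    simp only [LinearMap.compr₂_apply, LinearMap.compl₂_apply, LinearMap.comp_apply]
    refine Fin.cases ?_ (fun i => ?_) i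
    · suffices h : mulAt (n + 1) 0 ∘ₗ actAt ρ.act (n + 2) (comulAt (n + 1) 0
            (TPow.cons n (c ⊗ₜ[k] w))) ∘ₗ (TPow.cons (n + 1)).toLinearMap ∘ₗ
            TensorProduct.mk k A _ a = actAt ρ.act (n + 1) (TPow.cons n (c ⊗ₜ[k] w)) ∘ₗ
            mulAt (n + 1) 0 ∘ₗ (TPow.cons (n + 1)).toLinearMap ∘ₗ TensorProduct.mk k A _ a from
        LinearMap.congr_fun h u
      refine TPow.hom_ext_cons fun b u => ?_
      simp only [LinearMap.comp_apply, TensorProduct.mk_apply, LinearEquiv.coe_coe]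
      rw [mulAt_zero_cons, comulAt_zero_cons, actAt_cons_tmul, ρ.act_mul, tensorAct,
        LinearMap.comp_apply]
      generalize (comul c : C ⊗[k] C) = y
      induction y using TensorProduct.induction_on with
      | zero => simp
      | add x y hx hy => simp only [map_add, TensorProduct.add_tmul, LinearMap.add_apply, hx, hy]
      | tmul c d =>
        rw [TensorProduct.assoc_tmul, LinearMap.lTensor_tmul, LinearEquiv.coe_coe, actAt_cons_tmul,
          actAt_cons_tmul, mulAt_zero_cons, TensorProduct.map₂_apply_tmul, TensorProduct.map_tmul,
          LinearMap.mul'_apply]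
    · rw [comulAt_succ_cons, actAt_cons_tmul, mulAt_succ_cons, mulAt_succ_cons, ih,
        actAt_cons_tmul]

theorem act_one_eq_smul (ρ : EquivariantAction k H C A) (c : C) :
    ρ.act c 1 = (counit c : k) • (1 : A) := by
  rw [ρ.act_one, Algebra.algebraMap_eq_smul_one]

theorem unitAt_actAt_counitAt (ρ : EquivariantAction k H C A) (n : ℕ) (i : Fin (n + 1))
    (w : TPow k C (n + 1)) (u : TPow k A n) :
    unitAt n i (actAt ρ.act n (counitAt n i w) u) = actAt ρ.act (n + 1) w (unitAt n i u) := by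
  suffices h : ((actAt ρ.act n ∘ₗ counitAt n i).compr₂ (unitAt n i)) =
      (actAt ρ.act (n + 1)).compl₂ (unitAt n i) from LinearMap.congr_fun₂ h w u
  have zero (n : ℕ) : ((actAt ρ.act n ∘ₗ counitAt n 0).compr₂ (unitAt n 0)) =
      (actAt ρ.act (n + 1)).compl₂ (unitAt n 0) := by
    refine TPow.hom_ext_cons fun c w => LinearMap.ext fun u => ?_
    simp only [LinearMap.compr₂_apply, LinearMap.compl₂_apply, LinearMap.comp_apply]
    rw [counitAt_zero_cons, unitAt_zero, unitAt_zero, actAt_cons_tmul, act_one_eq_smul, map_smul,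
      LinearMap.smul_apply, TensorProduct.smul_tmul]
  induction n with
  | zero =>
    obtain rfl : i = 0 := Fin.fin_one_eq_zero i
    exact zero 0
  | succ n ih =>
    refine Fin.cases (zero (n + 1)) (fun i => ?_) i
    refine TPow.hom_ext_cons₂ fun c w a u => ?_
    -- The induction hypothesis is an equality of bilinear maps; the zeros fill arguments that it
    -- does not mention.
    have h := LinearMap.congr_fun₂ (ih i (0 : TPow k C (n + 1)) (0 : TPow k A n)) w u
    simp only [LinearMap.compr₂_apply, LinearMap.compl₂_apply, LinearMap.comp_apply] at h ⊢
    rw [counitAt_succ_cons, actAt_cons_tmul, unitAt_succ_cons, unitAt_succ_cons, actAt_cons_tmul, h]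

/-- The slotwise action commutes with a simultaneous permutation of both tensors, and the two
rotations are mutually inverse. This is the untwisted part of compatibility with `t`. -/
theorem lastFirst_map₂_firstLast (ρ : C →ₗ[k] A →ₗ[k] A) (n : ℕ) (y : C ⊗[k] TPow k C n)
    (z : A ⊗[k] TPow k A n) :
    lastFirst n (TensorProduct.map₂ ρ (actAt ρ n) (firstLast n y) z) =
      TensorProduct.map₂ ρ (actAt ρ n) y (lastFirst n z) := by
  induction n with
  | zero => rfl
  | succ n ih =>
    induction y using TensorProduct.induction_on with
    | zero => simp
    | add x y hx hy => simp only [map_add, LinearMap.add_apply, hx, hy]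
    | tmul c w =>
    obtain ⟨y, rfl⟩ := (TPow.cons n).surjective w
    induction y using TensorProduct.induction_on with
    | zero => simp
    | add x y hx hy => simp only [map_add, TensorProduct.tmul_add, LinearMap.add_apply, hx, hy]
    | tmul d w =>
    induction z using TensorProduct.induction_on with
    | zero => simp
    | add x y hx hy => simp only [map_add, hx, hy]
    | tmul a u =>
    obtain ⟨z, rfl⟩ := (TPow.cons n).surjective u
    rw [firstLast_succ, TensorProduct.map₂_apply_tmul, TensorProduct.map_tmul, actAt_cons,
      lastFirst_succ, lastFirst_succ, ih]
    generalize lastFirst n z = z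
    induction z using TensorProduct.induction_on with
    | zero => simp
    | add x y hx hy => simp only [map_add, TensorProduct.tmul_add, hx, hy]
    | tmul b u =>
      simp [actAt_cons_tmul]

end Action

/-! ### Naturality and rotation of the action on `M ⊗_H -`. -/

section Balanced

variable {k H : Type u} [Field k] [Ring H] [HopfAlgebra k H] [BijectiveAntipode k H]
variable {C A M : Type u} [AddCommGroup C] [Module k C] [Coalgebra k C] [Module H C]
  [IsScalarTower k H C] [Ring A] [Algebra k A] [Module H A] [IsScalarTower k H A]
  [AddCommGroup M] [Module k M] [Module Hᵐᵒᵖ M] [IsScalarTower k Hᵐᵒᵖ M]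

theorem balanced_hom_ext {W N : Type u} [AddCommGroup W] [Module k W] [AddCommGroup N]
    [Module k N] {σ : H →ₗ[k] W →ₗ[k] W} {f g : Balanced M σ →ₗ[k] N}
    (h : ∀ m w, f ((balancedRel M σ).mkQ (m ⊗ₜ[k] w)) = g ((balancedRel M σ).mkQ (m ⊗ₜ[k] w))) :
    f = g :=
  Submodule.linearMap_qext _ (TensorProduct.ext' h)

theorem balancedAct_mk (ρ : EquivariantAction k H C A) (n : ℕ) (m : M) (w : TPow k C n)
    (u : TPow k A n) :
    balancedAct M ρ n ((balancedRel M (diag C n)).mkQ (m ⊗ₜ[k] w)) u =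
      (balancedRel M (diag A n)).mkQ (m ⊗ₜ[k] actAt ρ.act n w u) :=
  rfl

theorem balancedAct_natural (ρ : EquivariantAction k H C A) {n n' : ℕ}
    {f : TPow k C n →ₗ[k] TPow k C n'}
    (hf : Equivariant (k := k) (H := H) (diag C n) (diag C n') f)
    {g : TPow k A n' →ₗ[k] TPow k A n}
    (hg : Equivariant (k := k) (H := H) (diag A n') (diag A n) g)
    (h : ∀ w u, g (actAt ρ.act n' (f w) u) = actAt ρ.act n w (g u))
    (x : Balanced M (diag (k := k) (H := H) C n)) (u : TPow k A n') :
    balancedMap g hg (balancedAct M ρ n' (balancedMap f hf x) u) = balancedAct M ρ n x (g u) := by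
  suffices e : ((balancedAct M ρ n') ∘ₗ balancedMap f hf).compr₂ (balancedMap g hg) =
      (balancedAct M ρ n).compl₂ g from LinearMap.congr_fun₂ e x u
  refine balanced_hom_ext fun m w => LinearMap.ext fun u => ?_
  exact congrArg (fun v => (balancedRel M (diag A n)).mkQ (m ⊗ₜ[k] v)) (h w u)

variable [SAYDModule k H M]

/-- The twists by `S⁻¹(m₍₋₁₎)` and by `m₍₋₁₎` cancel:
`m₍₀₎ ⊗ S⁻¹(m₍₋₁₎) m₍₋₂₎ b ⊗ v = m ⊗ b ⊗ v`. -/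
theorem twist_antipodeInv_twistAux {W : Type u} [AddCommGroup W] [Module k W] (m : M) (b : A)
    (v : W) :
    twist (antipodeInv k H) W (twistAux LinearMap.id b v (SAYDModule.coact (k := k) (H := H) m)) =
      m ⊗ₜ[k] (b ⊗ₜ[k] v) := by
  let ν : H ⊗[k] H →ₗ[k] H :=
    LinearMap.mul' k H ∘ₗ (TensorProduct.comm k H H).toLinearMap ∘ₗ (antipodeInv k H).lTensor H
  have hν : ν ∘ₗ comul = Algebra.linearMap k H ∘ₗ counit := by
    -- `S` is injective and reverses products, so applying it to `ν(g ⊗ h) = S⁻¹(h) g` gives `S(g)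
    -- h` and reduces the claim to the antipode axiom.
    have hS : antipode k (A := H) ∘ₗ ν = LinearMap.mul' k H ∘ₗ (antipode k (A := H)).rTensor H := by
      refine TensorProduct.ext' fun g h => ?_
      simp [ν, antipode_mul_antidistrib, antipode_antipodeInv]
    refine LinearMap.ext fun g => (BijectiveAntipode.bijective (k := k) (H := H)).injective ?_
    have h := LinearMap.congr_fun hS (comul g)
    simp only [LinearMap.comp_apply] at h ⊢
    rw [h, mul_antipode_rTensor_comul_apply]
    simp [Algebra.algebraMap_eq_smul_one, antipode_one]
  -- The two successive coactions are collected into one map on `H ⊗ H ⊗ M`, to which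
  -- coassociativity applies.
  have h1 : twist (antipodeInv k H) W ∘ₗ twistAux (M := M) LinearMap.id b v =
      twistAux LinearMap.id b v ∘ₗ ν.rTensor M ∘ₗ
        (TensorProduct.assoc k H H M).symm.toLinearMap ∘ₗ
          (SAYDModule.coact (k := k) (H := H) (M := M)).lTensor H := by
    refine TensorProduct.ext' fun g m => ?_
    simp only [LinearMap.comp_apply, twistAux_tmul, twist_tmul, LinearMap.lTensor_tmul,
      LinearEquiv.coe_coe]
    generalize SAYDModule.coact (k := k) (H := H) m = y
    induction y using TensorProduct.induction_on with
    | zero => simp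
    | add x y hx hy => simp only [map_add, TensorProduct.tmul_add, hx, hy]
    | tmul h m => simp [twistAux_tmul, ν, leftAct]
  have h2 := LinearMap.congr_fun h1 (SAYDModule.coact (k := k) (H := H) m)
  simp only [LinearMap.comp_apply, LinearEquiv.coe_coe] at h2
  rw [h2, ← SAYDModule.coassoc, LinearEquiv.symm_apply_apply, ← LinearMap.comp_apply (ν.rTensor M),
    ← LinearMap.rTensor_comp, hν]
  conv_rhs => rw [← SAYDModule.counit_coact (k := k) (H := H) m]
  generalize SAYDModule.coact (k := k) (H := H) m = y
  induction y using TensorProduct.induction_on with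
  | zero => simp
  | add x y hx hy => simp only [map_add, TensorProduct.add_tmul, hx, hy]
  | tmul h m =>
    simp [twistAux_tmul, leftAct, Algebra.algebraMap_eq_smul_one, TensorProduct.smul_tmul]

/-- After the two permutations are cancelled, the twist by `m₍₋₁₎` on the `C` side and the twist by
`S⁻¹(m₍₋₁₎)` on the `A` side fall on the same slot and cancel. -/
theorem balancedAct_rotate [ModuleCoalgebra k H C] [ModuleAlgebra k H A]
    (ρ : EquivariantAction k H C A) (n : ℕ)
    (x : Balanced M (diag (k := k) (H := H) C (n + 1))) (u : TPow k A (n + 1)) :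
    balancedLift _ ((balancedRel M (diag (H := H) A (n + 1))).mkQ ∘ₗ rotateA n)
        (rotateA_balanced n) (balancedAct M ρ (n + 1)
          (balancedLift _ ((balancedRel M (diag (H := H) C (n + 1))).mkQ ∘ₗ rotateC n)
            (rotateC_balanced n) x) u) =
      balancedAct M ρ (n + 1) x (rotate k A n u) := by
  obtain ⟨z, rfl⟩ := (TPow.cons n).surjective u
  obtain ⟨x, rfl⟩ := (balancedRel M (diag (H := H) C (n + 1))).mkQ_surjective x
  induction x using TensorProduct.induction_on with
  | zero => simp
  | add x y hx hy => simp only [map_add, LinearMap.add_apply, hx, hy]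
  | tmul m w =>
  obtain ⟨y, rfl⟩ := (TPow.cons n).surjective w
  induction y using TensorProduct.induction_on with
  | zero => simp
  | add x y hx hy =>
    simp only [map_add, TensorProduct.tmul_add, LinearMap.add_apply] at hx hy ⊢
    rw [hx, hy]
  | tmul c w =>
  -- Cancels the permutations; the coaction of `m` is replaced by an arbitrary tensor so that
  -- linearity can be used.
  have h1 : ∀ y : M ⊗[k] (C ⊗[k] TPow k C n),
      balancedLift _ ((balancedRel M (diag (H := H) A (n + 1))).mkQ ∘ₗ rotateA n)
        (rotateA_balanced n) (balancedAct M ρ (n + 1) ((balancedRel M (diag C (n + 1))).mkQ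
          (((TPow.cons n).toLinearMap ∘ₗ firstLast n).lTensor M y)) (TPow.cons n z)) =
      (balancedRel M (diag A (n + 1))).mkQ ((TPow.cons n).toLinearMap.lTensor M
        (twist (antipodeInv k H) _
          (((TensorProduct.map₂ ρ.act (actAt ρ.act n)).flip (lastFirst n z)).lTensor M y))) := by
    intro y
    induction y using TensorProduct.induction_on with
    | zero => simp
    | add x y hx hy => simp only [map_add, LinearMap.add_apply, hx, hy]
    | tmul m y =>
      rw [LinearMap.lTensor_tmul, LinearMap.lTensor_tmul, balancedAct_mk, LinearMap.comp_apply,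
        LinearEquiv.coe_coe, actAt_cons, LinearMap.flip_apply, ← lastFirst_map₂_firstLast]
      refine congrArg (balancedRel M (diag A (n + 1))).mkQ ?_
      simp only [rotateA, LinearMap.comp_apply, LinearMap.lTensor_tmul, LinearEquiv.coe_coe,
        LinearEquiv.symm_apply_apply]
  -- Cancels the twists: `(m₍₋₁₎c)a = m₍₋₁₎(ca)` puts both on the element `ca` of `A`.
  have h2 : ∀ z : A ⊗[k] TPow k A n, twist (antipodeInv k H) _
      (((TensorProduct.map₂ ρ.act (actAt ρ.act n)).flip z).lTensor M
        (twistAux LinearMap.id c w (SAYDModule.coact (k := k) (H := H) m))) =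
      m ⊗ₜ[k] TensorProduct.map₂ ρ.act (actAt ρ.act n) (c ⊗ₜ[k] w) z := by
    intro z
    induction z using TensorProduct.induction_on with
    | zero => simp
    | add x y hx hy =>
      simp only [map_add, LinearMap.lTensor_add, LinearMap.add_apply, hx, hy,
        TensorProduct.tmul_add]
    | tmul a u =>
      rw [TensorProduct.map₂_apply_tmul, TensorProduct.map_tmul,
        ← twist_antipodeInv_twistAux (H := H) m (ρ.act c a) (actAt ρ.act n w u)]
      congr 1
      generalize SAYDModule.coact (k := k) (H := H) m = y
      induction y using TensorProduct.induction_on with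
      | zero => simp
      | add x y hx hy => simp only [map_add, hx, hy]
      | tmul g m =>
        have := ρ.smul_act g c a
        simp [twistAux_tmul, leftAct, this]
  rw [rotate_cons, balancedAct_mk, actAt_cons]
  refine Eq.trans ?_ ((h1 _).trans (congrArg (fun v => (balancedRel M (diag A (n + 1))).mkQ
    ((TPow.cons n).toLinearMap.lTensor M v)) (h2 (lastFirst n z))))
  rw [← rotateC_tmul]
  rfl

end Balanced

/-! ### The Janus morphism, and its value at `1` on Hochschild boundaries. -/

section Janus

variable {k H : Type u} [Field k] [Ring H] [HopfAlgebra k H] [BijectiveAntipode k H]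
variable {C A M : Type u} [AddCommGroup C] [Module k C] [Coalgebra k C] [Module H C]
  [IsScalarTower k H C] [ModuleCoalgebra k H C] [Ring A] [Algebra k A] [Module H A]
  [IsScalarTower k H A] [ModuleAlgebra k H A]
  [AddCommGroup M] [Module k M] [Module Hᵐᵒᵖ M] [IsScalarTower k Hᵐᵒᵖ M] [SAYDModule k H M]

theorem coalgebraCocyclic_d_castSucc (n : ℕ) (i : Fin (n + 1)) :
    (coalgebraCocyclic k H C M).d n i.castSucc =
      balancedMap (comulAt (n + 1) i) (comulAt_equivariant (n + 1) i) := by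
  simp only [coalgebraCocyclic, Fin.lastCases_castSucc]
  rfl

theorem coalgebraCocyclic_d_last (n : ℕ) :
    (coalgebraCocyclic k H C M).d n (Fin.last (n + 1)) =
      (coalgebraCocyclic k H C M).t (n + 1) ∘ₗ (coalgebraCocyclic k H C M).d n 0 := by
  rw [← Fin.castSucc_zero, coalgebraCocyclic_d_castSucc]
  simp only [coalgebraCocyclic, Fin.lastCases_last]
  rfl

theorem algebraCocyclic_d_castSucc (n : ℕ) (i : Fin (n + 1)) :
    (algebraCocyclic k H A M).d n i.castSucc = (balancedMap (M := M) (mulAt (n + 1) i)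
      (mulAt_equivariant (k := k) (H := H) (A := A) (n + 1) i)).dualMap := by
  simp only [algebraCocyclic, Fin.lastCases_castSucc]
  rfl

theorem algebraCocyclic_d_last (n : ℕ) :
    (algebraCocyclic k H A M).d n (Fin.last (n + 1)) =
      (algebraCocyclic k H A M).t (n + 1) ∘ₗ (algebraCocyclic k H A M).d n 0 := by
  rw [← Fin.castSucc_zero, algebraCocyclic_d_castSucc]
  simp only [algebraCocyclic, Fin.lastCases_last]
  rfl

theorem ordinaryCocyclic_d_castSucc (n : ℕ) (i : Fin (n + 1)) :
    (ordinaryCocyclic k A).d n i.castSucc = (mulAt (k := k) (A := A) (n + 1) i).dualMap := by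
  simp only [ordinaryCocyclic, Fin.lastCases_castSucc]
  rfl

theorem ordinaryCocyclic_d_last (n : ℕ) :
    (ordinaryCocyclic k A).d n (Fin.last (n + 1)) =
      (ordinaryCocyclic k A).t (n + 1) ∘ₗ (ordinaryCocyclic k A).d n 0 := by
  rw [← Fin.castSucc_zero, ordinaryCocyclic_d_castSucc]
  simp only [ordinaryCocyclic, Fin.lastCases_last]
  rfl

theorem janus_t (ρ : EquivariantAction k H C A) (n : ℕ) (x : (coalgebraCocyclic k H C M).obj n)
    (φ : (algebraCocyclic k H A M).obj n) :
    janus M ρ n ((coalgebraCocyclic k H C M).t n x) ((algebraCocyclic k H A M).t n φ) =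
      (ordinaryCocyclic k A).t n (janus M ρ n x φ) :=
  LinearMap.ext fun u => congrArg
    (show Module.Dual k (Balanced M (diag (k := k) (H := H) A (n + 1))) from φ)
    (balancedAct_rotate ρ n x u)

theorem janus_d_castSucc (ρ : EquivariantAction k H C A) (n : ℕ) (i : Fin (n + 1))
    (x : (coalgebraCocyclic k H C M).obj n) (φ : (algebraCocyclic k H A M).obj n) :
    janus M ρ (n + 1) ((coalgebraCocyclic k H C M).d n i.castSucc x)
        ((algebraCocyclic k H A M).d n i.castSucc φ) =
      (ordinaryCocyclic k A).d n i.castSucc (janus M ρ n x φ) := by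
  rw [coalgebraCocyclic_d_castSucc, algebraCocyclic_d_castSucc, ordinaryCocyclic_d_castSucc]
  exact LinearMap.ext fun u => congrArg
    (show Module.Dual k (Balanced M (diag (k := k) (H := H) A (n + 1))) from φ)
    (balancedAct_natural ρ _ _ (mulAt_actAt_comulAt ρ (n + 1) i) x u)

theorem janus_isDiagonalMorphism (ρ : EquivariantAction k H C A) :
    IsDiagonalMorphism (coalgebraCocyclic k H C M) (algebraCocyclic k H A M)
      (ordinaryCocyclic k A) (janus M ρ) where
  t := janus_t ρ
  s n j x φ := LinearMap.ext fun u => congrArg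
    (show Module.Dual k (Balanced M (diag (k := k) (H := H) A (n + 2))) from φ)
    (balancedAct_natural ρ (counitAt_equivariant (n + 1) j.succ)
      (unitAt_equivariant (n + 1) j.succ) (unitAt_actAt_counitAt ρ (n + 1) j.succ) x u)
  d n i x φ := by
    refine Fin.lastCases ?_ (fun i => janus_d_castSucc ρ n i x φ) i
    rw [coalgebraCocyclic_d_last, algebraCocyclic_d_last, ordinaryCocyclic_d_last]
    exact (janus_t ρ (n + 1) _ _).trans
      (congrArg ((ordinaryCocyclic k A).t (n + 1)) (janus_d_castSucc ρ n 0 x φ))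

theorem dual_b_zero (X : CocyclicData k) (v : X.obj 1) :
    X.dual.b 0 v = X.s 0 0 v - X.s 0 0 (X.t 1 v) := by
  have h0 := LinearMap.congr_fun (X.dual_face_castSucc 0 0) v
  have h1 := LinearMap.congr_fun (X.dual_face_last 0) v
  have h : X.dual.b 0 v = X.dual.face 0 (Fin.castSucc 0) v - X.dual.face 0 (Fin.last 1) v :=
    CyclicData.b_zero_apply (F := X.dual) v
  rw [h, h0, h1]
  rfl

theorem counit_antipodeInv (g : H) : (counit (antipodeInv k H g) : k) = counit g := by
  rw [← counit_antipode, antipode_antipodeInv]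

variable (k H A M) in
/-- `m ↦ m ⊗ 1`, as a map `M → M ⊗_H A`. -/
def balancedOne : M →ₗ[k] Balanced M (diag (k := k) (H := H) A 1) :=
  (balancedRel M (diag A 1)).mkQ ∘ₗ
    (TensorProduct.mk k M (TPow k A 1)).flip (TPow.cons 0 ((1 : A) ⊗ₜ[k] TPow.nil (1 : k)))

theorem balancedAct_one (ρ : EquivariantAction k H C A) (m : M) (c : C) :
    balancedAct M ρ 1
        ((balancedRel M (diag C 1)).mkQ (m ⊗ₜ[k] TPow.cons 0 (c ⊗ₜ[k] TPow.nil (1 : k))))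
        (TPow.cons 0 ((1 : A) ⊗ₜ[k] TPow.nil (1 : k))) =
      (counit c : k) • balancedOne k H A M m := by
  rw [balancedAct_mk, actAt_cons_tmul, act_one_eq_smul]
  simp [balancedOne, actAt, ← TensorProduct.smul_tmul']

/-- The codegeneracy `s₀` on `M ⊗_H C ⊗ C`, paired with `1 ∈ A`, is invariant under rotation. -/
theorem balancedAct_counitAt_rotate (ρ : EquivariantAction k H C A)
    (x : Balanced M (diag (k := k) (H := H) C 2)) :
    balancedAct M ρ 1 (balancedMap (counitAt 1 1) (counitAt_equivariant 1 1)
        (balancedLift _ ((balancedRel M (diag (H := H) C 2)).mkQ ∘ₗ rotateC 1)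
          (rotateC_balanced 1) x)) (TPow.cons 0 ((1 : A) ⊗ₜ[k] TPow.nil (1 : k))) =
      balancedAct M ρ 1 (balancedMap (counitAt 1 1) (counitAt_equivariant 1 1) x)
        (TPow.cons 0 ((1 : A) ⊗ₜ[k] TPow.nil (1 : k))) := by
  -- Acting on `1` leaves only counits, an expression symmetric in `c` and `d`; a rotation can then
  -- change it only through the coaction.
  have hs : ∀ (m : M) (c d : C), balancedAct M ρ 1
      (balancedMap (counitAt 1 1) (counitAt_equivariant (H := H) 1 1)
        ((balancedRel M (diag C 2)).mkQ (m ⊗ₜ[k] TPow.cons 1 (c ⊗ₜ[k]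
          TPow.cons 0 (d ⊗ₜ[k] TPow.nil (1 : k))))))
        (TPow.cons 0 ((1 : A) ⊗ₜ[k] TPow.nil (1 : k))) =
      (counit d : k) • (counit c : k) • balancedOne k H A M m := by
    intro m c d
    have h : counitAt 1 1 (TPow.cons 1 (c ⊗ₜ[k] TPow.cons 0 (d ⊗ₜ[k] TPow.nil (1 : k)))) =
        (counit d : k) • TPow.cons 0 (c ⊗ₜ[k] TPow.nil (1 : k)) := by
      refine (counitAt_succ_cons 0 0 c _).trans ?_
      rw [counitAt_zero_cons, TensorProduct.tmul_smul, map_smul]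
    rw [← balancedAct_one ρ, ← LinearMap.smul_apply, ← map_smul, ← map_smul,
      ← TensorProduct.tmul_smul, ← h]
    rfl
  let E : Balanced M (diag (k := k) (H := H) C 2) →ₗ[k] Balanced M (diag (k := k) (H := H) A 1) :=
    (balancedAct M ρ 1).flip (TPow.cons 0 ((1 : A) ⊗ₜ[k] TPow.nil (1 : k))) ∘ₗ
      balancedMap (counitAt 1 1) (counitAt_equivariant 1 1)
  suffices h : ∀ m : M, E ∘ₗ (balancedRel M (diag C 2)).mkQ ∘ₗ rotateC 1 ∘ₗ
      TensorProduct.mk k M _ m = E ∘ₗ (balancedRel M (diag C 2)).mkQ ∘ₗ TensorProduct.mk k M _ m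
    from LinearMap.congr_fun (f := E ∘ₗ balancedLift _
      ((balancedRel M (diag (H := H) C 2)).mkQ ∘ₗ rotateC 1) (rotateC_balanced 1)) (g := E)
      (balanced_hom_ext fun m w => LinearMap.congr_fun (h m) w) x
  refine fun m => TPow.hom_ext_tprod fun v => ?_
  refine Eq.trans ?_ (hs m (v 0) (v 1)).symm
  change E ((balancedRel M (diag C 2)).mkQ (rotateC 1 (m ⊗ₜ[k] TPow.cons 1 (v 0 ⊗ₜ[k]
    TPow.cons 0 (v 1 ⊗ₜ[k] TPow.nil (1 : k)))))) = _
  rw [rotateC_tmul]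
  -- Writing `m` as `ε(m₍₋₁₎) m₍₀₎` matches the factor `ε(m₍₋₁₎ c) = ε(m₍₋₁₎) ε(c)` produced by the
  -- rotation.
  conv_rhs => rw [← SAYDModule.counit_coact (k := k) (H := H) m]
  generalize SAYDModule.coact (k := k) (H := H) m = y
  induction y using TensorProduct.induction_on with
  | zero => simp
  | add x y hx hy => simp only [map_add, smul_add, hx, hy]
  | tmul g m =>
    have hc : (counit (leftAct k H C g (v 0)) : k) = counit g * counit (v 0) :=
      ModuleCoalgebra.counit_smul g (v 0)
    rw [twistAux_tmul, LinearMap.lTensor_tmul, LinearMap.comp_apply (TPow.cons 1).toLinearMap,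
      firstLast_succ]
    refine (hs m (v 1) (leftAct k H C g (v 0))).trans ?_
    rw [hc, LinearMap.rTensor_tmul, TensorProduct.lid_tmul, map_smul]
    simp only [smul_smul]
    congr 1
    ring

/-- The codegeneracy `s₀` on `Hom(M ⊗_H A ⊗ A, k)`, evaluated at `1 ∈ A`, is invariant under
rotation. -/
theorem rotate_unitAt_balancedOne (m : M) :
    balancedLift _ ((balancedRel M (diag (H := H) A 2)).mkQ ∘ₗ rotateA 1) (rotateA_balanced 1)
        (balancedMap (unitAt 1 1) (unitAt_equivariant 1 1) (balancedOne k H A M m)) =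
      balancedMap (unitAt 1 1) (unitAt_equivariant 1 1) (balancedOne k H A M m) := by
  have hu : unitAt 1 1 (TPow.cons 0 ((1 : A) ⊗ₜ[k] TPow.nil (1 : k))) =
      TPow.cons 1 ((1 : A) ⊗ₜ[k] TPow.cons 0 ((1 : A) ⊗ₜ[k] TPow.nil (1 : k))) := by
    refine (unitAt_succ_cons 0 0 _ _).trans ?_
    rw [unitAt_zero]
  change (balancedRel M (diag A 2)).mkQ (rotateA 1 (m ⊗ₜ[k] unitAt 1 1 _)) =
    (balancedRel M (diag A 2)).mkQ (m ⊗ₜ[k] unitAt 1 1 _)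
  congr 1
  rw [hu]
  simp only [rotateA, LinearMap.comp_apply, LinearMap.lTensor_tmul, LinearEquiv.coe_coe,
    LinearEquiv.symm_apply_apply, lastFirst_succ]
  rw [lastFirst, LinearMap.id_apply, TensorProduct.leftComm_tmul, LinearMap.lTensor_tmul,
    twist_tmul]
  conv_rhs => rw [← SAYDModule.counit_coact (k := k) (H := H) m]
  generalize SAYDModule.coact (k := k) (H := H) m = y
  induction y using TensorProduct.induction_on with
  | zero => simp
  | add x y hx hy => simp only [map_add, TensorProduct.add_tmul, hx, hy]
  | tmul g m =>
    -- `S⁻¹` preserves the counit, so the twist acts on the unit by `ε(m₍₋₁₎)`.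
    have ho : leftAct k H A (antipodeInv k H g) 1 = (counit g : k) • (1 : A) := by
      rw [← counit_antipodeInv g, ← Algebra.algebraMap_eq_smul_one]
      exact ModuleAlgebra.smul_one _
    rw [twistAux_tmul, ho, LinearMap.rTensor_tmul, TensorProduct.lid_tmul, LinearMap.lTensor_tmul,
      TensorProduct.smul_tmul, TensorProduct.tmul_smul, map_smul]
    exact (TensorProduct.smul_tmul _ _ _).symm

theorem janus_dual_b_left (ρ : EquivariantAction k H C A) (v : (coalgebraCocyclic k H C M).obj 1)
    (φ : (algebraCocyclic k H A M).obj 0) :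
    evalOne A (janus M ρ 0 ((coalgebraCocyclic k H C M).dual.b 0 v) φ) = 0 := by
  rw [dual_b_zero, map_sub, LinearMap.sub_apply]
  refine (map_sub (evalOne A) _ _).trans (sub_eq_zero.mpr ?_)
  exact (congrArg (show Module.Dual k (Balanced M (diag (k := k) (H := H) A 1)) from φ)
    (balancedAct_counitAt_rotate ρ v)).symm

theorem janus_dual_b_right (ρ : EquivariantAction k H C A) (x : (coalgebraCocyclic k H C M).obj 0)
    (ψ : (algebraCocyclic k H A M).obj 1) :
    evalOne A (janus M ρ 0 x ((algebraCocyclic k H A M).dual.b 0 ψ)) = 0 := by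
  -- `C` acts on `1` through `ε`, so only the elements `m ⊗ 1` need to be tested.
  have hx : ∃ m : M, balancedAct M ρ 1 x (TPow.cons 0 ((1 : A) ⊗ₜ[k] TPow.nil (1 : k))) =
      balancedOne k H A M m := by
    obtain ⟨x, rfl⟩ := (balancedRel M (diag (H := H) C 1)).mkQ_surjective x
    induction x using TensorProduct.induction_on with
    | zero => exact ⟨0, by simp⟩
    | add x y hx hy =>
      obtain ⟨m, hm⟩ := hx
      obtain ⟨m', hm'⟩ := hy
      exact ⟨m + m', by rw [map_add, map_add, LinearMap.add_apply, hm, hm', map_add]⟩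
    | tmul m w =>
      obtain ⟨y, rfl⟩ := (TPow.cons 0).surjective w
      induction y using TensorProduct.induction_on with
      | zero => exact ⟨0, by simp⟩
      | add x y hx hy =>
        obtain ⟨m, hm⟩ := hx
        obtain ⟨m', hm'⟩ := hy
        refine ⟨m + m', ?_⟩
        rw [map_add, TensorProduct.tmul_add, map_add, map_add, LinearMap.add_apply, hm, hm',
          map_add]
      | tmul c w =>
        obtain ⟨r, rfl⟩ := TPow.nil_eq_smul w
        refine ⟨r • (counit c : k) • m, ?_⟩
        rw [map_smul, map_smul, ← balancedAct_one ρ]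
        simp only [TensorProduct.tmul_smul, map_smul, LinearMap.smul_apply]
  obtain ⟨m, hm⟩ := hx
  rw [dual_b_zero, map_sub]
  refine (map_sub (evalOne A) _ _).trans (sub_eq_zero.mpr ?_)
  change (show Module.Dual k (Balanced M (diag (k := k) (H := H) A 2)) from ψ)
    (balancedMap (unitAt 1 1) (unitAt_equivariant 1 1) (balancedAct M ρ 1 x _)) =
    (show Module.Dual k (Balanced M (diag (k := k) (H := H) A 2)) from ψ)
    (balancedLift _ ((balancedRel M (diag (H := H) A 2)).mkQ ∘ₗ rotateA 1) (rotateA_balanced 1)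
      (balancedMap (unitAt 1 1) (unitAt_equivariant 1 1) (balancedAct M ρ 1 x _)))
  rw [hm, rotate_unitAt_balancedOne]

end Janus

end
end HopfCyclic

theorem mainTheorem8 {k H C A M : Type u} [Field k] [Ring H] [HopfAlgebra k H]
    [HopfCyclic.BijectiveAntipode k H]
    [AddCommGroup C] [Module k C] [Coalgebra k C] [Module H C] [IsScalarTower k H C]
    [HopfCyclic.ModuleCoalgebra k H C]
    [Ring A] [Nontrivial A] [Algebra k A] [Module H A] [IsScalarTower k H A]
    [HopfCyclic.ModuleAlgebra k H A]
    [AddCommGroup M] [Module k M] [Module Hᵐᵒᵖ M] [IsScalarTower k Hᵐᵒᵖ M]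
    [HopfCyclic.SAYDModule k H M]
    (ρ : HopfCyclic.EquivariantAction k H C A) :
    HopfCyclic.IsDiagonalMorphism (HopfCyclic.coalgebraCocyclic k H C M)
      (HopfCyclic.algebraCocyclic k H A M) (HopfCyclic.ordinaryCocyclic k A)
      (HopfCyclic.janus M ρ) ∧
    (∀ p : ℕ, Even p → Function.Bijective (HopfCyclic.pointFunctional (k := k) A p)) ∧
    (∀ p : ℕ, Odd p → Subsingleton (HopfCyclic.DualHC (HopfCyclic.ordinaryCocyclic k A) p)) ∧
    ∃! β : ∀ p : ℕ, HopfCyclic.DualHC (HopfCyclic.coalgebraCocyclic k H C M) p →ₗ[k]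
        HopfCyclic.DualHC (HopfCyclic.algebraCocyclic k H A M) p →ₗ[k] k,
      ∃ μ : ∀ p : ℕ, HopfCyclic.DualHC (HopfCyclic.coalgebraCocyclic k H C M) p →ₗ[k]
          HopfCyclic.DualHC (HopfCyclic.algebraCocyclic k H A M) p →ₗ[k]
            HopfCyclic.DualHC (HopfCyclic.ordinaryCocyclic k A) p,
        HopfCyclic.IsInducedProduct (HopfCyclic.coalgebraCocyclic k H C M)
          (HopfCyclic.algebraCocyclic k H A M) (HopfCyclic.ordinaryCocyclic k A)
          (HopfCyclic.janus M ρ) μ ∧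
        ∀ p ξ η, β p ξ η = HopfCyclic.pointFunctional A p (μ p ξ η) :=
  ⟨HopfCyclic.janus_isDiagonalMorphism ρ, HopfCyclic.pointFunctional_bijective,
    HopfCyclic.dualHC_subsingleton,
    HopfCyclic.existsUnique_pairing _ _ _ _ (HopfCyclic.pointFunctional A) (HopfCyclic.evalOne A)
      (HopfCyclic.pointFunctional_cls_even Even.zero) HopfCyclic.pointFunctional_S
      HopfCyclic.pointFunctional_bijective (fun _ => HopfCyclic.pointFunctional_odd)
      (HopfCyclic.janus_dual_b_left ρ) (HopfCyclic.janus_dual_b_right ρ)⟩
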